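/- Let $n\ge 1$ and $r\ge 1$ be integers with $r\mid n$. Consider $n$ servers, initially idle, each with a first-come first-serve queue, partitioned into $n/r$ groups of $r$ servers. Each arriving job is forked to one of the groups, chosen uniformly at random: one task of the job joins the queue of each of the $r$ servers of that group. As soon as any one task of the job is served, its other tasks are canceled and leave their queues immediately. The task service times are i.i.d. across jobs and servers, distributed as a random variable $X>0$; the group choices are i.i.d.; arrivals, group choices and service times are independent of each other. Let $X_{1:r}$ be the minimum of $r$ i.i.d. copies of $X$. Let the cost $C_j$ be the total time spent by the servers serving the $j$-th job (a task canceled before it starts service contributes $0$), and let the latency $T_j$ be the time from the arrival of the $j$-th job until one of its tasks is complete. (Cost.) For any arrival process, every job has expected cost $$\mathbb E[C_j]=r\,\mathbb E[X_{1:r}].$$ (Latency.) If the jobs arrive according to a Poisson process of rate $\lambda>0$ and $\lambda r\,\mathbb E[X_{1:r}]<n$, then the law of $T_j$ converges weakly, as $j\to\infty$, to a (steady-state) law, and if $T$ has this law then $$\mathbb E[T]=\lim_{j\to\infty}\mathbb E[T_j]=\mathbb E[X_{1:r}]+\frac{\lambda r\,\mathbb E[X_{1:r}^2]}{2\bigl(n-\lambda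 r\,\mathbb E[X_{1:r}]\bigr)}.$$ All the expectations are taken in $[0,\infty]$; in particular $\mathbb E[T]=\infty$ if $\mathbb E[X_{1:r}^2]=\infty$. -/

import Mathlib

open MeasureTheory ProbabilityTheory Filter Topology
open scoped ENNReal

noncomputable section

namespace ForkJoin

/-! ### Sample-path dynamics of the partial-fork-join system

There are `n` servers with first-come first-serve queues, all idle at time `0`.  Job `j` arrives at
time `a j` and is forked to the servers in `S j`; its task at server `s` needs service time `x j s`.
As soon as one of its tasks is served, the others are cancelled and leave their queues. -/

/-- The time at which job `j`, arriving at time `a`, is completed, when server `s` has been released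
by all earlier jobs at time `f s`.  Its task at server `s` starts at time `max a (f s)`; the job is
complete when the first of its tasks is. -/
def finish {n : ℕ} (a : ℝ) (S : Finset (Fin n)) (x f : Fin n → ℝ) : ℝ :=
  ⨅ s : S, (max a (f s) + x s)

/-- `free a S x j s` is the time from which no task of a job with index `< j` is present any more at
server `s`.  A task of a job leaves its server (served or cancelled) when the job is complete. -/
def free {n : ℕ} (a : ℕ → ℝ) (S : ℕ → Finset (Fin n)) (x : ℕ → Fin n → ℝ) : ℕ → Fin n → ℝ
  | 0, _ => 0
  | j + 1, s =>
      if s ∈ S j then max (free a S x j s) (finish (a j) (S j) (x j) (free a S x j))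
      else free a S x j s

/-- The time at which the task of job `j` at server `s` reaches the head of the queue of `s`
and (unless cancelled by then) starts service. -/
def start {n : ℕ} (a : ℕ → ℝ) (S : ℕ → Finset (Fin n)) (x : ℕ → Fin n → ℝ)
    (j : ℕ) (s : Fin n) : ℝ :=
  max (a j) (free a S x j s)

/-- The time at which job `j` is complete and exits the system. -/
def completion {n : ℕ} (a : ℕ → ℝ) (S : ℕ → Finset (Fin n)) (x : ℕ → Fin n → ℝ) (j : ℕ) : ℝ :=
  ⨅ s : S j, (start a S x j s + x j s)

theorem completion_eq_finish {n : ℕ} (a : ℕ → ℝ) (S : ℕ → Finset (Fin n)) (x : ℕ → Fin n → ℝ)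
    (j : ℕ) : completion a S x j = finish (a j) (S j) (x j) (free a S x j) := rfl

/-- The latency of job `j`: the time from its arrival until one of its tasks is complete. -/
def latency {n : ℕ} (a : ℕ → ℝ) (S : ℕ → Finset (Fin n)) (x : ℕ → Fin n → ℝ) (j : ℕ) : ℝ :=
  completion a S x j - a j

/-- The computing cost of job `j`: the total time spent by the servers serving it.  A server whose
task is cancelled before it starts contributes `0`. -/
def cost {n : ℕ} (a : ℕ → ℝ) (S : ℕ → Finset (Fin n)) (x : ℕ → Fin n → ℝ) (j : ℕ) : ℝ :=
  ∑ s ∈ S j, max (completion a S x j - start a S x j s) 0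

/-! ### The group-based random policy -/

/-- The set of servers in group `g`, where `grp` assigns to each server its group. -/
def group {n m : ℕ} (grp : Fin n → Fin m) (g : Fin m) : Finset (Fin n) :=
  Finset.univ.filter fun s => grp s = g

/-- The random latency of job `j` when job `i` is forked to the servers of the group `G i`. -/
def groupLatency {Ω : Type*} {n m : ℕ} (grp : Fin n → Fin m) (A : ℕ → Ω → ℝ) (G : ℕ → Ω → Fin m)
    (X : ℕ → Fin n → Ω → ℝ) (j : ℕ) (ω : Ω) : ℝ :=
  latency (fun i => A i ω) (fun i => group grp (G i ω)) (fun i s => X i s ω) j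

/-- The random computing cost of job `j` when job `i` is forked to the servers of the group `G i`. -/
def groupCost {Ω : Type*} {n m : ℕ} (grp : Fin n → Fin m) (A : ℕ → Ω → ℝ) (G : ℕ → Ω → Fin m)
    (X : ℕ → Fin n → Ω → ℝ) (j : ℕ) (ω : Ω) : ℝ :=
  cost (fun i => A i ω) (fun i => group grp (G i ω)) (fun i s => X i s ω) j

/-- The probabilistic model: `A j` is the arrival time of job `j`, `G j` is the group that it is
forked to, and `X j s` is the service time of a task of job `j` at server `s`.  Each of the `m`
groups has `r` servers.  The arrival process is arbitrary; the groups are chosen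
independently and uniformly; the service times are i.i.d. with law `F` across jobs and servers;
arrivals, choices and service times are independent of each other. -/
structure IsGroupBasedSystem {Ω : Type*} [MeasurableSpace Ω] (P : Measure Ω) (F : Measure ℝ)
    {n m : ℕ} (r : ℕ) (grp : Fin n → Fin m) (A : ℕ → Ω → ℝ) (G : ℕ → Ω → Fin m)
    (X : ℕ → Fin n → Ω → ℝ) : Prop where
  card_group : ∀ g, (group grp g).card = r
  measurable_arrival : ∀ j, Measurable (A j)
  arrival_nonneg : ∀ᵐ ω ∂P, 0 ≤ A 0 ω
  arrival_mono : ∀ᵐ ω ∂P, Monotone fun j => A j ω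
  measurable_choice : ∀ j, Measurable (G j)
  choice_uniform : ∀ j g, P (G j ⁻¹' {g}) = (m : ℝ≥0∞)⁻¹
  choice_indep : iIndepFun G P
  measurable_service : ∀ j s, Measurable (X j s)
  service_law : ∀ j s, P.map (X j s) = F
  service_indep : iIndepFun (fun p : ℕ × Fin n => X p.1 p.2) P
  arrival_indep : IndepFun (fun ω j => A j ω) (fun ω => (fun j => G j ω, fun j s => X j s ω)) P
  choice_indep_service : IndepFun (fun ω j => G j ω) (fun ω j s => X j s ω) P

/-- The time between the arrivals of job `j - 1` and job `j` (from time `0` if `j = 0`). -/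
def interarrival {Ω : Type*} (A : ℕ → Ω → ℝ) : ℕ → Ω → ℝ
  | 0, ω => A 0 ω
  | j + 1, ω => A (j + 1) ω - A j ω

/-- `A 0, A 1, …` are the points of a Poisson process with rate `lam` on `(0, ∞)`. -/
structure IsPoissonArrivals {Ω : Type*} [MeasurableSpace Ω] (P : Measure Ω) (lam : ℝ)
    (A : ℕ → Ω → ℝ) : Prop where
  law : ∀ j, P.map (interarrival A j) = expMeasure lam
  indep : iIndepFun (interarrival A) P

/-- `E[X_{1:r} ^ k]`, where `X_{1:r}` is the minimum of `r` i.i.d. random variables with law `F`. -/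
def minMoment (F : Measure ℝ) (r k : ℕ) : ℝ≥0∞ :=
  ∫⁻ x : Fin r → ℝ, ENNReal.ofReal ((⨅ i, x i) ^ k) ∂(Measure.pi fun _ => F)

/-- `ν` is the steady-state law of the sequence `T`: the law of `T j` converges weakly to `ν`. -/
def IsSteadyStateLaw {Ω : Type*} [MeasurableSpace Ω] (P : Measure Ω) [IsProbabilityMeasure P]
    (T : ℕ → Ω → ℝ) (ν : ProbabilityMeasure ℝ) : Prop :=
  TendstoInDistribution T atTop (id : ℝ → ℝ) (fun _ => P) (ν : Measure ℝ)

end ForkJoin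

end

set_option linter.unusedSectionVars false

noncomputable section

namespace ForkJoin

/-! The servers of a group hold the same tasks, are idle at the start, and lose each job at the same
instant. So they are always released together (`start_eq`), and the group acts as one server whose
service time is the minimum over the group. The cost formula follows path by path: no task is
cancelled before it starts, and each of the `r` servers works for exactly this minimum (`cost_eq`).

For the latency, fix a group and let every job of the whole stream count as an arrival to it, with
work zero if the job is forked elsewhere. No thinning of the Poisson process is needed: the group is
an M/G/1 queue with i.i.d. works and exponential interarrival times of rate `lam` (`isQueueInput`).
Reversing the order of the inputs turns `workload` into `backlog`, which has the same law for each
`j` but increases with `j` (`identDistrib_backlog_workload`, `monotone_backlog`). Below load one it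
converges almost surely by the strong law of large numbers (`ae_tendsto_backlog`). This gives the
limit law, and monotone convergence gives its mean.

The value of the mean comes from the identity E[((Y - t)⁺)²] + (2/lam) E[(Y - t)⁺] = E[Y²] for an
exponential `t` independent of Y ≥ 0. With Y the work of a job plus a backlog, the second moment of
the backlog appears on both sides with coefficient one. It cancels in the limit and leaves a linear
equation for the mean. The cancellation needs a finite limit, which the analogous third-moment
recursion supplies for bounded works; truncation and monotone convergence remove the bound
(`tendsto_backMoment`).

Finally, the group chosen by a job is independent of the latency the job would have in any given
group, and that latency has the same law in all groups; so the random choice does not change the law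
(`identDistrib_groupLatency`). -/

/-! ### Independence and laws -/

/-- The σ-algebra generated by the members of a family with indices in `S`. -/
abbrev sigmaOf {Ω ι : Type*} (Z : ι → Ω → ℝ) (S : Set ι) : MeasurableSpace Ω :=
  ⨆ i ∈ S, MeasurableSpace.comap (Z i) inferInstance

lemma measurable_sigmaOf {Ω ι : Type*} {Z : ι → Ω → ℝ} {S : Set ι} {i : ι} (hi : i ∈ S) :
    Measurable[sigmaOf Z S] (Z i) :=
  (comap_measurable (Z i)).mono
    (le_iSup₂ (f := fun i (_ : i ∈ S) => MeasurableSpace.comap (Z i) inferInstance) i hi) le_rfl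

lemma sigmaOf_mono {Ω ι : Type*} {Z : ι → Ω → ℝ} {S T : Set ι} (h : S ⊆ T) :
    sigmaOf Z S ≤ sigmaOf Z T :=
  iSup₂_le fun i hi =>
    le_iSup₂ (f := fun i (_ : i ∈ T) => MeasurableSpace.comap (Z i) inferInstance) i (h hi)

section Independence

variable {Ω : Type*} [MeasurableSpace Ω] {P : Measure Ω}

/-- Two independent families that are independent of each other form one independent family. -/
lemma iIndepFun_sumElim {ι κ E : Type*} [MeasurableSpace E] {U : ι → Ω → E} {V : κ → Ω → E}
    (hU : iIndepFun U P) (hV : iIndepFun V P)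
    (hUV : IndepFun (fun ω i => U i ω) (fun ω i => V i ω) P) :
    iIndepFun (Sum.elim U V) P := by
  rw [iIndepFun_iff_measure_inter_preimage_eq_mul]
  intro S sets hS
  have hsplit : (⋂ i ∈ S, Sum.elim U V i ⁻¹' sets i)
      = (⋂ i ∈ S.toLeft, U i ⁻¹' sets (Sum.inl i)) ∩
        ⋂ i ∈ S.toRight, V i ⁻¹' sets (Sum.inr i) := by
    ext ω
    simp [Sum.forall]
  have hl : (⋂ i ∈ S.toLeft, U i ⁻¹' sets (Sum.inl i))
      = (fun ω i => U i ω) ⁻¹' (⋂ i ∈ S.toLeft, (fun f : ι → E => f i) ⁻¹' sets (Sum.inl i)) := by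
    ext ω; simp
  have hr : (⋂ i ∈ S.toRight, V i ⁻¹' sets (Sum.inr i))
      = (fun ω i => V i ω) ⁻¹' (⋂ i ∈ S.toRight, (fun f : κ → E => f i) ⁻¹' sets (Sum.inr i)) := by
    ext ω; simp
  have hml : MeasurableSet (⋂ i ∈ S.toLeft, (fun f : ι → E => f i) ⁻¹' sets (Sum.inl i)) :=
    Finset.measurableSet_biInter _ fun i hi =>
      measurable_pi_apply i (hS _ (by simpa using hi))
  have hmr : MeasurableSet (⋂ i ∈ S.toRight, (fun f : κ → E => f i) ⁻¹' sets (Sum.inr i)) :=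
    Finset.measurableSet_biInter _ fun i hi =>
      measurable_pi_apply i (hS _ (by simpa using hi))
  rw [hsplit, hl, hr, hUV.measure_inter_preimage_eq_mul _ _ hml hmr, ← hl, ← hr,
    hU.measure_inter_preimage_eq_mul S.toLeft (fun i hi => hS _ (by simpa using hi)),
    hV.measure_inter_preimage_eq_mul S.toRight (fun i hi => hS _ (by simpa using hi))]
  conv_rhs => rw [← Finset.toLeft_disjSum_toRight (u := S), Finset.prod_disjSum]
  rfl

/-- The rows of a doubly indexed independent family are independent. -/
lemma iIndepFun_rows {ι κ E : Type*} [MeasurableSpace E] [Countable ι] [Countable κ]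
    {X : ι → κ → Ω → E}
    (mX : ∀ i j, Measurable (X i j)) (h : iIndepFun (fun p : ι × κ => X p.1 p.2) P) :
    iIndepFun (fun i ω => (X i · ω)) P := by
  have := h.isProbabilityMeasure
  have : ∀ i j, IsProbabilityMeasure (P.map (X i j)) :=
    fun i j => Measure.isProbabilityMeasure_map (mX i j).aemeasurable
  have hrow : ∀ i, iIndepFun (X i) P := fun i =>
    h.precomp (g := fun j => (i, j)) (Prod.mk_right_injective i)
  have h1 := (iIndepFun_iff_map_fun_eq_infinitePi_map (by fun_prop)).1 h
  rw [iIndepFun_iff_map_fun_eq_infinitePi_map (by fun_prop)]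
  have h2 : (fun ω i j => X i j ω) = MeasurableEquiv.curry ι κ E ∘ (fun ω p => X p.1 p.2 ω) := by
    ext; rfl
  rw [h2, ← Measure.map_map (by fun_prop) (by fun_prop), h1,
    Measure.infinitePi_map_curry (fun i j => P.map (X i j))]
  congr with i : 1
  rw [(iIndepFun_iff_map_fun_eq_infinitePi_map (by fun_prop)).1 (hrow i)]

/-- Functions of disjoint parts of an independent family are independent. -/
lemma indepFun_of_disjoint {ι : Type*} {Z : ι → Ω → ℝ} (hZ : ∀ i, Measurable (Z i))
    (h : iIndepFun Z P) {S T : Set ι} (hST : Disjoint S T) {E E' : Type*} [MeasurableSpace E]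
    [MeasurableSpace E'] {f : Ω → E} {g : Ω → E'}
    (hf : Measurable[sigmaOf Z S] f) (hg : Measurable[sigmaOf Z T] g) : IndepFun f g P := by
  have hind := indep_iSup_of_disjoint (fun i => (hZ i).comap_le) h.iIndep hST
  exact indep_of_indep_of_le_left (indep_of_indep_of_le_right hind hg.comap_le) hf.comap_le

lemma measurable_select {m : ℕ} {G : Ω → Fin m} (hG : Measurable G)
    {Y : Fin m → Ω → ℝ} (hY : ∀ g, Measurable (Y g)) : Measurable fun ω => Y (G ω) ω :=
  (measurable_from_prod_countable_right (f := fun p : Fin m × Ω => Y p.1 p.2) hY).comp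
    (hG.prodMk measurable_id)

/-- A random member of a family of variables with the same law has that law, if the choice is
independent of every member. -/
lemma map_select [IsProbabilityMeasure P] {m : ℕ} {G : Ω → Fin m} (hG : Measurable G)
    {Y : Fin m → Ω → ℝ} (hY : ∀ g, Measurable (Y g)) {μ : Measure ℝ}
    (hind : ∀ g s, MeasurableSet s → P (G ⁻¹' {g} ∩ Y g ⁻¹' s) = P (G ⁻¹' {g}) * P (Y g ⁻¹' s))
    (hlaw : ∀ g, P.map (Y g) = μ) : P.map (fun ω => Y (G ω) ω) = μ := by
  have hm := measurable_select hG hY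
  ext s hs
  rw [Measure.map_apply hm hs]
  have hdec : (fun ω => Y (G ω) ω) ⁻¹' s = ⋃ g, (G ⁻¹' {g} ∩ Y g ⁻¹' s) := by
    ext ω; simp
  rw [hdec, measure_iUnion _ fun g => (hG (measurableSet_singleton g)).inter (hY g hs)]
  · have : ∀ g, P (G ⁻¹' {g} ∩ Y g ⁻¹' s) = P (G ⁻¹' {g}) * μ s := fun g => by
      rw [hind g s hs, ← hlaw g, Measure.map_apply (hY g) hs]
    simp_rw [this]
    rw [ENNReal.tsum_mul_right, ← measure_iUnion _ fun g => hG (measurableSet_singleton g)]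
    · have : (⋃ g, G ⁻¹' {g}) = Set.univ := by ext ω; simp
      rw [this, measure_univ, one_mul]
    · intro g g' hgg'
      exact Disjoint.preimage _ (by simpa using hgg')
  · intro g g' hgg'
    exact (Disjoint.preimage G (by simpa using hgg')).mono Set.inter_subset_left
      Set.inter_subset_left

lemma identDistrib_of_map_eq {f g : Ω → ℝ} (hf : Measurable f) (hg : Measurable g)
    (h : P.map f = P.map g) : IdentDistrib f g P P :=
  ⟨hf.aemeasurable, hg.aemeasurable, h⟩

end Independence

/-! ### Exponential interarrival times -/

lemma lintegral_expMeasure {lam : ℝ} {f : ℝ → ℝ≥0∞} (hf : Measurable f) :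
    ∫⁻ t, f t ∂(expMeasure lam) = ∫⁻ t, exponentialPDF lam t * f t := by
  have hm : Measurable (exponentialPDF lam) :=
    (measurable_exponentialPDFReal lam).ennreal_ofReal
  exact lintegral_withDensity_eq_lintegral_mul _ hm hf

/-- Neither power alone has so simple a primitive against the exponential density; this combination
does, which is why consecutive moments are always taken together below. -/
lemma hasDerivAt_exp_mul_pow (lam y t : ℝ) (hlam : lam ≠ 0) (k : ℕ) :
    HasDerivAt (fun t => -(Real.exp (-(lam * t)) * (y - t) ^ (k + 1)))
      (lam * Real.exp (-(lam * t)) * ((y - t) ^ (k + 1) + (k + 1) / lam * (y - t) ^ k)) t := by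
  have h1 : HasDerivAt (fun t => Real.exp (-(lam * t))) (Real.exp (-(lam * t)) * -(lam * 1)) t :=
    (((hasDerivAt_id t).const_mul lam).neg).exp
  have h2 : HasDerivAt (fun t => (y - t) ^ (k + 1)) (((k + 1 : ℕ) : ℝ) * (y - t) ^ k * -1) t := by
    exact ((hasDerivAt_id t).const_sub y).fun_pow (k + 1)
  convert! (h1.mul h2).neg using 1
  push_cast
  field_simp
  ring

/-- For an exponential time `t` with rate `lam` and `k ≥ 1`,
`E[((y - t)⁺) ^ (k + 1)] + (k + 1) / lam * E[((y - t)⁺) ^ k] = y ^ (k + 1)`. -/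
lemma lintegral_expMeasure_pow_succ {lam y : ℝ} (hlam : 0 < lam) (hy : 0 ≤ y) {k : ℕ}
    (hk : k ≠ 0) :
    ∫⁻ t, ENNReal.ofReal (y - t) ^ (k + 1) ∂(expMeasure lam)
      + ENNReal.ofReal ((k + 1) / lam) * ∫⁻ t, ENNReal.ofReal (y - t) ^ k ∂(expMeasure lam)
      = ENNReal.ofReal y ^ (k + 1) := by
  have hm : ∀ k : ℕ, Measurable fun t : ℝ => ENNReal.ofReal (y - t) ^ k := by
    intro k; fun_prop
  set g : ℝ → ℝ := fun t =>
    lam * Real.exp (-(lam * t)) * ((y - t) ^ (k + 1) + (k + 1) / lam * (y - t) ^ k) with hg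
  have hgc : Continuous g := by rw [hg]; fun_prop
  rw [← lintegral_const_mul _ (hm k), ← lintegral_add_left (hm (k + 1)),
    lintegral_expMeasure (by fun_prop)]
  -- The density vanishes for `t < 0` and the truncated powers vanish for `t > y`. The latter uses
  -- `k ≠ 0`, since `0 ^ 0 = 1`.
  have hpt : ∀ t, exponentialPDF lam t * (ENNReal.ofReal (y - t) ^ (k + 1)
      + ENNReal.ofReal ((k + 1) / lam) * ENNReal.ofReal (y - t) ^ k)
      = (Set.Icc 0 y).indicator (fun t => ENNReal.ofReal (g t)) t := by
    intro t
    rcases lt_or_ge t 0 with ht | ht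
    · rw [exponentialPDF_of_neg ht, zero_mul, Set.indicator_of_notMem (by simp [ht])]
    rcases lt_or_ge y t with hyt | hyt
    · rw [ENNReal.ofReal_of_nonpos (by linarith), Set.indicator_of_notMem (by simp [hyt])]
      simp [hk]
    · have h0 : 0 ≤ y - t := by linarith
      rw [Set.indicator_of_mem (Set.mem_Icc.2 ⟨ht, hyt⟩), exponentialPDF_of_nonneg ht,
        ← ENNReal.ofReal_pow h0, ← ENNReal.ofReal_pow h0, ← ENNReal.ofReal_mul (by positivity),
        ← ENNReal.ofReal_add (by positivity) (by positivity),
        ← ENNReal.ofReal_mul (by positivity)]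
  simp_rw [hpt]
  rw [lintegral_indicator measurableSet_Icc, ← ofReal_integral_eq_lintegral_ofReal
    (hgc.integrableOn_Icc), integral_Icc_eq_integral_Ioc,
    ← intervalIntegral.integral_of_le hy,
    intervalIntegral.integral_eq_sub_of_hasDerivAt
      (fun t _ => hasDerivAt_exp_mul_pow lam y t hlam.ne' k) (hgc.intervalIntegrable 0 y),
    ← ENNReal.ofReal_pow hy]
  · simp
  · refine (ae_restrict_iff' measurableSet_Icc).2 (Eventually.of_forall fun t ht => ?_)
    have h0 : 0 ≤ y - t := by linarith [ht.2]
    simp only [hg, Pi.zero_apply]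
    positivity

/-- Needed for the drift of the increments in the strong law. -/
lemma integrable_id_expMeasure {lam : ℝ} (hlam : 0 < lam) :
    Integrable (fun t : ℝ => t) (expMeasure lam) ∧ ∫ t, t ∂(expMeasure lam) = 1 / lam := by
  have hnn : ∀ᵐ t ∂(expMeasure lam), (0 : ℝ) ≤ t := by
    have : ∫⁻ t, (Set.Iio (0 : ℝ)).indicator 1 t ∂(expMeasure lam) = 0 := by
      rw [lintegral_expMeasure (measurable_one.indicator measurableSet_Iio)]
      rw [← lintegral_zero (μ := (volume : Measure ℝ))]
      congr with t
      rcases lt_or_ge t 0 with ht | ht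
      · simp [exponentialPDF_of_neg ht]
      · simp [ht]
    rw [lintegral_indicator_one measurableSet_Iio] at this
    rw [ae_iff]
    simpa [Set.Iio] using this
  have hl : ∫⁻ t, ENNReal.ofReal t ∂(expMeasure lam) = ENNReal.ofReal (1 / lam) := by
    rw [lintegral_expMeasure (by fun_prop)]
    have hpt : ∀ t, exponentialPDF lam t * ENNReal.ofReal t
        = (Set.Ioi 0).indicator
          (fun t => ENNReal.ofReal (lam * (t ^ ((2 : ℝ) - 1) * Real.exp (-(lam * t))))) t := by
      intro t
      rcases le_or_gt t 0 with ht | ht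
      · rw [ENNReal.ofReal_of_nonpos ht, mul_zero, Set.indicator_of_notMem (by simpa using ht)]
      · rw [Set.indicator_of_mem (Set.mem_Ioi.2 ht), exponentialPDF_of_nonneg ht.le,
          ← ENNReal.ofReal_mul (by positivity)]
        congr 1
        norm_num
        ring
    have hint := Real.integral_rpow_mul_exp_neg_mul_Ioi (a := 2) (r := lam) (by norm_num) hlam
    have hI : IntegrableOn (fun t : ℝ => t ^ ((2 : ℝ) - 1) * Real.exp (-(lam * t)))
        (Set.Ioi 0) := by
      -- The integral of a non-integrable function is `0` by convention, whereas the Gamma formula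
      -- gives a positive value.
      by_contra hcon
      rw [integral_undef hcon] at hint
      rw [Real.Gamma_two] at hint
      have : 0 < (1 / lam) ^ (2 : ℝ) * 1 := by positivity
      linarith
    simp_rw [hpt]
    rw [lintegral_indicator measurableSet_Ioi, ← ofReal_integral_eq_lintegral_ofReal
      (hI.const_mul lam), integral_const_mul, hint]
    · rw [Real.Gamma_two]
      congr 1
      norm_num
      field_simp
    · refine (ae_restrict_iff' measurableSet_Ioi).2 (Eventually.of_forall fun t ht => ?_)
      have : (0 : ℝ) < t := ht
      simp only [Pi.zero_apply]
      positivity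
  have hi : Integrable (fun t : ℝ => t) (expMeasure lam) :=
    ⟨by fun_prop, by
      rw [hasFiniteIntegral_iff_ofReal hnn, hl]
      exact ENNReal.ofReal_lt_top⟩
  refine ⟨hi, ?_⟩
  rw [integral_eq_lintegral_of_nonneg_ae hnn (by fun_prop), hl,
    ENNReal.toReal_ofReal (by positivity)]

/-- The moment identity for a workload `Y` after an independent exponential time `t`. -/
lemma lintegral_sub_exp_pow_succ {Ω : Type*} [MeasurableSpace Ω] {P : Measure Ω}
    [IsProbabilityMeasure P] {lam : ℝ} (hlam : 0 < lam) {Y t : Ω → ℝ} (hY : Measurable Y)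
    (ht : Measurable t) (hY0 : ∀ ω, 0 ≤ Y ω) (hlaw : P.map t = expMeasure lam)
    (hind : IndepFun Y t P) {k : ℕ} (hk : k ≠ 0) :
    ∫⁻ ω, ENNReal.ofReal (Y ω - t ω) ^ (k + 1) ∂P
      + ENNReal.ofReal ((k + 1) / lam) * ∫⁻ ω, ENNReal.ofReal (Y ω - t ω) ^ k ∂P
      = ∫⁻ ω, ENNReal.ofReal (Y ω) ^ (k + 1) ∂P := by
  have := isProbabilityMeasure_expMeasure hlam
  have hprod := hind.map_prod_eq_prod_map_map hY.aemeasurable ht.aemeasurable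
  rw [hlaw] at hprod
  have hsplit : ∀ k : ℕ, ∫⁻ ω, ENNReal.ofReal (Y ω - t ω) ^ k ∂P
      = ∫⁻ ω, ∫⁻ s, ENNReal.ofReal (Y ω - s) ^ k ∂(expMeasure lam) ∂P := by
    intro k
    have hm : Measurable fun p : ℝ × ℝ => ENNReal.ofReal (p.1 - p.2) ^ k := by fun_prop
    have h1 := lintegral_map (μ := P) hm (hY.prodMk ht)
    rw [← h1, hprod, lintegral_prod _ hm.aemeasurable, lintegral_map hm.lintegral_prod_right' hY]
  have hm : ∀ k : ℕ, Measurable fun ω =>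
      ∫⁻ s, ENNReal.ofReal (Y ω - s) ^ k ∂(expMeasure lam) := by
    intro k
    have hm : Measurable fun p : ℝ × ℝ => ENNReal.ofReal (p.1 - p.2) ^ k := by fun_prop
    exact hm.lintegral_prod_right'.comp hY
  rw [hsplit, hsplit, ← lintegral_const_mul _ (hm k), ← lintegral_add_left (hm (k + 1))]
  exact lintegral_congr fun ω => lintegral_expMeasure_pow_succ hlam (hY0 ω) hk

/-! ### Workload recursions of a single queue -/

/-- The workload found by job `j` in a queue that is empty at first; job `i` brings work `b i`, and
time `t i` passes between jobs `i` and `i + 1`. -/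
def workload (b t : ℕ → ℝ) : ℕ → ℝ
  | 0 => 0
  | j + 1 => max 0 (b j + workload b t j - t j)

/-- The time-reversed workload: the maximum of the first `j` partial sums of `b - t` from index `i`
on. -/
def backlog (b t : ℕ → ℝ) : ℕ → ℕ → ℝ
  | 0, _ => 0
  | j + 1, i => max 0 (b i + backlog b t j (i + 1) - t i)

lemma backlog_nonneg (b t : ℕ → ℝ) (j i : ℕ) : 0 ≤ backlog b t j i := by
  cases j with
  | zero => exact le_rfl
  | succ j => exact le_max_left _ _

/-- This is what the reversal buys: the recursion adds a term at the far end of the maximum, whereas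
`workload` can go down from one job to the next. -/
lemma backlog_le_succ (b t : ℕ → ℝ) (j : ℕ) : ∀ i, backlog b t j i ≤ backlog b t (j + 1) i := by
  induction j with
  | zero => exact fun i => backlog_nonneg b t 1 i
  | succ j ih =>
    intro i
    exact max_le_max le_rfl (by linarith [ih (i + 1)])

lemma monotone_backlog (b t : ℕ → ℝ) (i : ℕ) : Monotone fun j => backlog b t j i :=
  monotone_nat_of_le_succ fun j => backlog_le_succ b t j i

lemma backlog_mono {b b' : ℕ → ℝ} (h : ∀ i, b i ≤ b' i) (t : ℕ → ℝ) (j : ℕ) :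
    ∀ i, backlog b t j i ≤ backlog b' t j i := by
  induction j with
  | zero => exact fun i => le_rfl
  | succ j ih =>
    intro i
    exact max_le_max le_rfl (by linarith [ih (i + 1), h i])

lemma tendsto_backlog {b : ℕ → ℕ → ℝ} {b' : ℕ → ℝ}
    (h : ∀ i, Tendsto (fun K => b K i) atTop (𝓝 (b' i))) (t : ℕ → ℝ) (j : ℕ) :
    ∀ i, Tendsto (fun K => backlog (b K) t j i) atTop (𝓝 (backlog b' t j i)) := by
  induction j with
  | zero => exact fun i => tendsto_const_nhds
  | succ j ih =>
    intro i
    exact tendsto_const_nhds.max (((h i).add (ih (i + 1))).sub tendsto_const_nhds)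

/-- Moving the start from `i` to `i + 1` removes the first increment from every partial sum, so the
bound `C` drops by that increment; hence `C` is quantified inside the induction. -/
lemma backlog_le_of_sum_le (b t : ℕ → ℝ) (j : ℕ) : ∀ (i : ℕ) (C : ℝ),
    (∀ k, ∑ l ∈ Finset.range k, (b (i + l) - t (i + l)) ≤ C) → backlog b t j i ≤ C := by
  induction j with
  | zero => exact fun i C h => by simpa [backlog] using h 0
  | succ j ih =>
    intro i C h
    refine max_le (by simpa using h 0) ?_
    have := ih (i + 1) (C - (b i - t i)) fun k => by
      have := h (k + 1)
      rw [Finset.sum_range_succ'] at this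
      simp only [add_zero] at this
      have hc : ∑ l ∈ Finset.range k, (b (i + 1 + l) - t (i + 1 + l))
          = ∑ l ∈ Finset.range k, (b (i + (l + 1)) - t (i + (l + 1))) :=
        Finset.sum_congr rfl fun l _ => by rw [add_assoc, add_comm 1 l]
      linarith
    linarith

lemma measurable_workload {Ω : Type*} {m : MeasurableSpace Ω} {B t : ℕ → Ω → ℝ} {j : ℕ}
    (hB : ∀ k < j, Measurable (B k)) (ht : ∀ k < j, Measurable (t k)) :
    Measurable fun ω => workload (fun k => B k ω) (fun k => t k ω) j := by
  induction j with
  | zero => exact measurable_const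
  | succ j ih =>
    exact measurable_const.max (((hB j j.lt_succ_self).add
      (ih (fun k hk => hB k (hk.trans j.lt_succ_self))
        fun k hk => ht k (hk.trans j.lt_succ_self))).sub (ht j j.lt_succ_self))

lemma measurable_backlog {Ω : Type*} {m : MeasurableSpace Ω} {B t : ℕ → Ω → ℝ} (j : ℕ) :
    ∀ i, (∀ k, i ≤ k → Measurable (B k)) → (∀ k, i ≤ k → Measurable (t k)) →
      Measurable fun ω => backlog (fun k => B k ω) (fun k => t k ω) j i := by
  induction j with
  | zero => exact fun i _ _ => measurable_const
  | succ j ih =>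
    intro i hB ht
    exact measurable_const.max (((hB i le_rfl).add
      (ih (i + 1) (fun k hk => hB k (by omega)) fun k hk => ht k (by omega))).sub (ht i le_rfl))

/-! ### The M/G/1 queue -/

/-- The input of an M/G/1 queue: works `B i` and interarrival times `t i`, all independent, the
works nonnegative with a common law, the interarrival times exponential with rate `lam`. -/
structure IsQueueInput {Ω : Type*} [MeasurableSpace Ω] (P : Measure Ω) (lam : ℝ)
    (B t : ℕ → Ω → ℝ) : Prop where
  measurable_work : ∀ i, Measurable (B i)
  measurable_time : ∀ i, Measurable (t i)
  work_nonneg : ∀ i ω, 0 ≤ B i ω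
  work_law : ∀ i j, P.map (B i) = P.map (B j)
  time_law : ∀ i, P.map (t i) = expMeasure lam
  indep : iIndepFun (Sum.elim B t) P

namespace IsQueueInput

variable {Ω : Type*} [MeasurableSpace Ω] {P : Measure Ω} {lam : ℝ}
  {B t : ℕ → Ω → ℝ}

lemma measurable_elim (h : IsQueueInput P lam B t) (x : ℕ ⊕ ℕ) : Measurable (Sum.elim B t x) := by
  cases x with
  | inl i => exact h.measurable_work i
  | inr i => exact h.measurable_time i

lemma measurable_back (h : IsQueueInput P lam B t) (j i : ℕ) :
    Measurable fun ω => backlog (fun k => B k ω) (fun k => t k ω) j i :=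
  measurable_backlog j i (fun k _ => h.measurable_work k) fun k _ => h.measurable_time k

/-- The indices of the works and times of jobs `≥ i`. -/
def after (i : ℕ) : Set (ℕ ⊕ ℕ) := {x | i ≤ Sum.elim id id x}

/-- The indices of the works and times of jobs `< i`. -/
def before (i : ℕ) : Set (ℕ ⊕ ℕ) := {x | Sum.elim id id x < i}

/-- Measurability for the σ-algebra of the inputs from `i` on, not just the ambient one, is what
gives independence of the earlier inputs. -/
lemma measurable_back_after (B t : ℕ → Ω → ℝ) (j i : ℕ) :
    Measurable[sigmaOf (Sum.elim B t) (after i)]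
      fun ω => backlog (fun k => B k ω) (fun k => t k ω) j i :=
  measurable_backlog j i
    (fun k hk => measurable_sigmaOf (Z := Sum.elim B t) (i := Sum.inl k) hk)
    fun k hk => measurable_sigmaOf (Z := Sum.elim B t) (i := Sum.inr k) hk

lemma measurable_workload_before (B t : ℕ → Ω → ℝ) (j : ℕ) :
    Measurable[sigmaOf (Sum.elim B t) (before j)]
      fun ω => workload (fun k => B k ω) (fun k => t k ω) j :=
  measurable_workload
    (fun k hk => measurable_sigmaOf (Z := Sum.elim B t) (i := Sum.inl k) hk)
    fun k hk => measurable_sigmaOf (Z := Sum.elim B t) (i := Sum.inr k) hk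

lemma measurable_work_pair (B t : ℕ → Ω → ℝ) (i : ℕ) :
    Measurable[sigmaOf (Sum.elim B t) {x | Sum.elim id id x = i}] fun ω => (B i ω, t i ω) :=
  (measurable_sigmaOf (Z := Sum.elim B t) (S := {x | Sum.elim id id x = i}) (i := Sum.inl i)
    rfl).prodMk (measurable_sigmaOf (Z := Sum.elim B t) (S := {x | Sum.elim id id x = i})
    (i := Sum.inr i) rfl)

lemma indepFun_work_time (h : IsQueueInput P lam B t) (i j : ℕ) : IndepFun (B i) (t j) P :=
  h.indep.indepFun (i := Sum.inl i) (j := Sum.inr j) (by simp)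

/-- The `k`-th moment of the backlog. -/
def backMoment (P : Measure Ω) (B t : ℕ → Ω → ℝ) (k j : ℕ) : ℝ≥0∞ :=
  ∫⁻ ω, ENNReal.ofReal (backlog (fun k => B k ω) (fun k => t k ω) j 0) ^ k ∂P

/-- The `k`-th moment of the work of a job. -/
def workMoment (P : Measure Ω) (B : ℕ → Ω → ℝ) (k : ℕ) : ℝ≥0∞ :=
  ∫⁻ ω, ENNReal.ofReal (B 0 ω) ^ k ∂P

lemma backMoment_mono (B t : ℕ → Ω → ℝ) (k : ℕ) : Monotone (backMoment P B t k) := by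
  intro j j' hj
  refine lintegral_mono fun ω => ?_
  exact pow_le_pow_left' (ENNReal.ofReal_le_ofReal (monotone_backlog _ _ 0 hj)) k

variable [IsProbabilityMeasure P]

lemma identDistrib_pair {B' t' : ℕ → Ω → ℝ} (h : IsQueueInput P lam B t)
    (h' : IsQueueInput P lam B' t') (hBB' : P.map (B 0) = P.map (B' 0)) (i j : ℕ) :
    IdentDistrib (fun ω => (B i ω, t i ω)) (fun ω => (B' j ω, t' j ω)) P P :=
  (identDistrib_of_map_eq (h.measurable_work i) (h'.measurable_work j)
    (by rw [h.work_law i 0, hBB', h'.work_law 0 j])).prodMk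
    (identDistrib_of_map_eq (h.measurable_time i) (h'.measurable_time j)
      (by rw [h.time_law, h'.time_law]))
    (h.indepFun_work_time i i) (h'.indepFun_work_time j j)

/-- The backlog and the workload have the same law. -/
lemma identDistrib_backlog_workload {B' t' : ℕ → Ω → ℝ} (h : IsQueueInput P lam B t)
    (h' : IsQueueInput P lam B' t') (hBB' : P.map (B 0) = P.map (B' 0)) (j : ℕ) : ∀ i,
    IdentDistrib (fun ω => backlog (fun k => B k ω) (fun k => t k ω) j i)
      (fun ω => workload (fun k => B' k ω) (fun k => t' k ω) j) P P := by
  induction j with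
  | zero => exact fun i => IdentDistrib.refl aemeasurable_const
  | succ j ih =>
    intro i
    -- The backlog peels off the input pair `i` and the workload the pair `j`. Each pair is
    -- independent of what remains, the pairs have equal laws, and both recursions apply the same
    -- function.
    have h1 := indepFun_of_disjoint h.measurable_elim h.indep
      (S := {x | Sum.elim id id x = i}) (T := after (i + 1))
      (Set.disjoint_left.2 fun x hx hx' => by
        simp only [Set.mem_ofPred_eq, after] at hx hx'; omega)
      (measurable_work_pair B t i) (measurable_back_after B t j (i + 1))
    have h2 := indepFun_of_disjoint h'.measurable_elim h'.indep
      (S := {x | Sum.elim id id x = j}) (T := before j)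
      (Set.disjoint_left.2 fun x hx hx' => by
        simp only [Set.mem_ofPred_eq, before] at hx hx'; omega)
      (measurable_work_pair B' t' j) (measurable_workload_before B' t' j)
    exact ((h.identDistrib_pair h' hBB' i j).prodMk (ih (i + 1)) h1 h2).comp
      (u := fun p : (ℝ × ℝ) × ℝ => max 0 (p.1.1 + p.2 - p.1.2)) (by fun_prop)

lemma identDistrib_backlog (h : IsQueueInput P lam B t) (j i i' : ℕ) :
    IdentDistrib (fun ω => backlog (fun k => B k ω) (fun k => t k ω) j i)
      (fun ω => backlog (fun k => B k ω) (fun k => t k ω) j i') P P :=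
  (h.identDistrib_backlog_workload h rfl j i).trans
    (h.identDistrib_backlog_workload h rfl j i').symm

lemma lintegral_backlog_pow (h : IsQueueInput P lam B t) (k j i : ℕ) :
    ∫⁻ ω, ENNReal.ofReal (backlog (fun k => B k ω) (fun k => t k ω) j i) ^ k ∂P
      = backMoment P B t k j :=
  ((h.identDistrib_backlog j i 0).comp
    (u := fun x => ENNReal.ofReal x ^ k) (by fun_prop)).lintegral_eq

lemma indepFun_work_backlog (h : IsQueueInput P lam B t) (j : ℕ) :
    IndepFun (B 0) (fun ω => backlog (fun k => B k ω) (fun k => t k ω) j 1) P :=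
  indepFun_of_disjoint h.measurable_elim h.indep (S := {Sum.inl 0}) (T := after 1)
    (by simp [after])
    (measurable_sigmaOf (Z := Sum.elim B t) (i := Sum.inl 0) rfl) (measurable_back_after B t j 1)

/-- The exponential moment identity applies with the workload `B 0` plus the backlog from index `1`,
which involves every input except `t 0`. The positive part in `backlog` is absorbed by
`ENNReal.ofReal`. -/
lemma backMoment_succ (h : IsQueueInput P lam B t) (hlam : 0 < lam) {k : ℕ} (hk : k ≠ 0) (j : ℕ) :
    backMoment P B t (k + 1) (j + 1)
      + ENNReal.ofReal ((k + 1) / lam) * backMoment P B t k (j + 1)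
      = ∫⁻ ω, (ENNReal.ofReal (B 0 ω)
          + ENNReal.ofReal (backlog (fun k => B k ω) (fun k => t k ω) j 1)) ^ (k + 1) ∂P := by
  have hle : sigmaOf (Sum.elim B t) (after 1) ≤ sigmaOf (Sum.elim B t) {Sum.inr 0}ᶜ :=
    sigmaOf_mono fun x hx => by
      rintro rfl
      simp [after] at hx
  have hind := indepFun_of_disjoint h.measurable_elim h.indep (S := {Sum.inr 0}ᶜ) (T := {Sum.inr 0})
    disjoint_compl_left
    (Measurable.add (measurable_sigmaOf (Z := Sum.elim B t) (i := Sum.inl 0) (by simp))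
      ((measurable_back_after B t j 1).mono hle le_rfl))
    (measurable_sigmaOf (Z := Sum.elim B t) (i := Sum.inr 0) rfl)
  have key := lintegral_sub_exp_pow_succ hlam
    (Y := fun ω => B 0 ω + backlog (fun k => B k ω) (fun k => t k ω) j 1)
    ((h.measurable_work 0).add (h.measurable_back j 1)) (h.measurable_time 0)
    (fun ω => add_nonneg (h.work_nonneg 0 ω) (backlog_nonneg _ _ _ _)) (h.time_law 0) hind hk
  have hmax : ∀ x : ℝ, ENNReal.ofReal (max 0 x) = ENNReal.ofReal x := fun x => by
    rw [ENNReal.ofReal_max, ENNReal.ofReal_zero, max_eq_right zero_le]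
  simp only [backMoment, backlog, zero_add, hmax]
  rw [key]
  refine lintegral_congr fun ω => ?_
  rw [ENNReal.ofReal_add (h.work_nonneg 0 ω) (backlog_nonneg _ _ _ _)]

lemma lintegral_work_mul_backlog (h : IsQueueInput P lam B t) (k l j : ℕ) :
    ∫⁻ ω, ENNReal.ofReal (B 0 ω) ^ k
        * ENNReal.ofReal (backlog (fun k => B k ω) (fun k => t k ω) j 1) ^ l ∂P
      = workMoment P B k * backMoment P B t l j := by
  have hm := h.measurable_back j 1
  have hw := h.measurable_work 0
  rw [← h.lintegral_backlog_pow l j 1]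
  exact lintegral_mul_eq_lintegral_mul_lintegral_of_indepFun (hw.ennreal_ofReal.pow_const k)
    (hm.ennreal_ofReal.pow_const l) ((h.indepFun_work_backlog j).comp
      (φ := fun x => ENNReal.ofReal x ^ k) (ψ := fun x => ENNReal.ofReal x ^ l)
      (by fun_prop) (by fun_prop))

/-- Expand the square: `B 0` is independent of the backlog from index `1`, whose law is that of the
backlog from index `0`. -/
lemma backMoment_two_succ (h : IsQueueInput P lam B t) (hlam : 0 < lam) (j : ℕ) :
    backMoment P B t 2 (j + 1) + ENNReal.ofReal (2 / lam) * backMoment P B t 1 (j + 1)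
      = backMoment P B t 2 j + 2 * (workMoment P B 1 * backMoment P B t 1 j)
        + workMoment P B 2 := by
  have hm := h.measurable_back j 1
  have hw := h.measurable_work 0
  have := h.backMoment_succ hlam one_ne_zero j
  norm_num at this
  rw [this, ← h.lintegral_work_mul_backlog 1 1, ← h.lintegral_backlog_pow 2 j 1, workMoment,
    ← lintegral_const_mul _ (by fun_prop), ← lintegral_add_left (by fun_prop),
    ← lintegral_add_right _ (by fun_prop)]
  exact lintegral_congr fun ω => by ring

lemma backMoment_three_succ (h : IsQueueInput P lam B t) (hlam : 0 < lam) (j : ℕ) :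
    backMoment P B t 3 (j + 1) + ENNReal.ofReal (3 / lam) * backMoment P B t 2 (j + 1)
      = backMoment P B t 3 j + 3 * (workMoment P B 1 * backMoment P B t 2 j)
        + 3 * (workMoment P B 2 * backMoment P B t 1 j) + workMoment P B 3 := by
  have hm := h.measurable_back j 1
  have hw := h.measurable_work 0
  have := h.backMoment_succ hlam two_ne_zero j
  norm_num at this
  rw [this, ← h.lintegral_work_mul_backlog 1 2, ← h.lintegral_work_mul_backlog 2 1,
    ← h.lintegral_backlog_pow 3 j 1, workMoment,
    ← lintegral_const_mul _ (by fun_prop), ← lintegral_const_mul _ (by fun_prop),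
    ← lintegral_add_left (by fun_prop), ← lintegral_add_left (by fun_prop),
    ← lintegral_add_right _ (by fun_prop)]
  exact lintegral_congr fun ω => by ring

end IsQueueInput

/-! ### The mean workload (Pollaczek–Khinchine formula) -/

/-- Monotone sequences satisfying the recursions of the first three moments of the workload. -/
lemma tendsto_of_moment_recursion {u v w : ℕ → ℝ} {lam b c d : ℝ} (hlam : 0 < lam) (hb : 0 ≤ b)
    (hc : 0 ≤ c) (hbl : lam * b < 1)
    (hu : Monotone u) (hv : Monotone v) (hw : Monotone w)
    (h2 : ∀ j, v (j + 1) + 2 / lam * u (j + 1) = v j + 2 * (b * u j) + c)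
    (h3 : ∀ j, w (j + 1) + 3 / lam * v (j + 1)
      = w j + 3 * (b * v j) + 3 * (c * u j) + d) :
    Tendsto u atTop (𝓝 (lam * c / (2 * (1 - lam * b)))) := by
  have hpos : 0 < 1 / lam - b := by
    rw [sub_pos, lt_div_iff₀ hlam]; linarith
  -- As `v` increases it can be dropped from `h2`, and `u j ≤ u (j + 1)` leaves `2 * (1 / lam - b) *
  -- u (j + 1) ≤ c`.
  have hub : ∀ j, u j ≤ c / (2 * (1 / lam - b)) := by
    intro j
    refine (hu j.le_succ).trans ?_
    rw [le_div_iff₀ (by positivity)]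
    have e1 := h2 j
    have e2 := hv j.le_succ
    have e3 := mul_le_mul_of_nonneg_left (hu j.le_succ) hb
    have e4 : (2 : ℝ) / lam = 2 * (1 / lam) := by ring
    rw [e4] at e1
    simp only [Nat.succ_eq_add_one] at *
    nlinarith
  -- The same argument one order higher, dropping `w` from `h3` and inserting the bound on `u`.
  have hvb : ∀ j, v j ≤ (c * (c / (2 * (1 / lam - b))) + d / 3) / (1 / lam - b) := by
    intro j
    refine (hv j.le_succ).trans ?_
    rw [le_div_iff₀ hpos]
    have e1 := h3 j
    have e2 := hw j.le_succ
    have e3 := mul_le_mul_of_nonneg_left (hv j.le_succ) hb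
    have e4 : (3 : ℝ) / lam = 3 * (1 / lam) := by ring
    have e5 := mul_le_mul_of_nonneg_left (hub j) hc
    rw [e4] at e1
    simp only [Nat.succ_eq_add_one] at *
    nlinarith
  have hU := tendsto_atTop_ciSup hu ⟨_, Set.forall_mem_range.2 hub⟩
  have hV := tendsto_atTop_ciSup hv ⟨_, Set.forall_mem_range.2 hvb⟩
  set U := ⨆ j, u j
  set V := ⨆ j, v j
  -- In the limit of `h2` the finite `V` occurs on both sides and cancels, so only an equation for
  -- `U` is left.
  have hl := ((tendsto_add_atTop_iff_nat 1).2 hV).add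
    (((tendsto_add_atTop_iff_nat 1).2 hU).const_mul (2 / lam))
  have hr := (hV.add ((hU.const_mul b).const_mul 2)).add_const c
  have heq := tendsto_nhds_unique hl (hr.congr fun j => (h2 j).symm)
  have hUeq : U = lam * c / (2 * (1 - lam * b)) := by
    have : 1 - lam * b ≠ 0 := by linarith
    field_simp at heq ⊢
    linarith
  rwa [← hUeq]

namespace IsQueueInput

variable {Ω : Type*} [MeasurableSpace Ω] {P : Measure Ω} [IsProbabilityMeasure P] {lam : ℝ}
  {B t : ℕ → Ω → ℝ}

lemma backMoment_zero {k : ℕ} (hk : k ≠ 0) : backMoment P B t k 0 = 0 := by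
  simp [backMoment, backlog, hk]

/-- Bounded works have finite moments of all orders; by induction on `j` the recursions keep the
first three backlog moments finite. They can then be read in `ℝ`, where cancelling is allowed. -/
lemma tendsto_backMoment_of_bounded (h : IsQueueInput P lam B t) (hlam : 0 < lam) {K : ℝ}
    (hK : ∀ ω, B 0 ω ≤ K) (hload : ENNReal.ofReal lam * workMoment P B 1 < 1) :
    Tendsto (backMoment P B t 1) atTop (𝓝 (ENNReal.ofReal lam * workMoment P B 2
      / (2 * (1 - ENNReal.ofReal lam * workMoment P B 1)))) := by
  have hwfin : ∀ k, workMoment P B k ≠ ∞ := by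
    intro k
    refine ((lintegral_mono fun ω => pow_le_pow_left' (ENNReal.ofReal_le_ofReal (hK ω)) k).trans_lt
      ?_).ne
    simp only [lintegral_const, measure_univ, mul_one]
    exact ENNReal.pow_lt_top ENNReal.ofReal_lt_top
  have h2lam : ENNReal.ofReal (2 / lam) ≠ 0 := by
    simpa using hlam
  have hfin : ∀ j, backMoment P B t 1 j ≠ ∞ ∧ backMoment P B t 2 j ≠ ∞ := by
    intro j
    induction j with
    | zero => simp [backMoment_zero]
    | succ j ih =>
      have e := h.backMoment_two_succ hlam j
      have hrhs : backMoment P B t 2 j + 2 * (workMoment P B 1 * backMoment P B t 1 j)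
          + workMoment P B 2 ≠ ∞ := by
        have := ENNReal.mul_ne_top (hwfin 1) ih.1
        exact ENNReal.add_ne_top.2 ⟨ENNReal.add_ne_top.2
          ⟨ih.2, ENNReal.mul_ne_top (by simp) this⟩, hwfin 2⟩
      rw [← e, ENNReal.add_ne_top] at hrhs
      refine ⟨fun htop => hrhs.2 ?_, hrhs.1⟩
      rw [htop, ENNReal.mul_top h2lam]
  have hfin3 : ∀ j, backMoment P B t 3 j ≠ ∞ := by
    intro j
    induction j with
    | zero => simp [backMoment_zero]
    | succ j ih =>
      have e := h.backMoment_three_succ hlam j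
      have hrhs : backMoment P B t 3 j + 3 * (workMoment P B 1 * backMoment P B t 2 j)
          + 3 * (workMoment P B 2 * backMoment P B t 1 j) + workMoment P B 3 ≠ ∞ := by
        have e1 := ENNReal.mul_ne_top (hwfin 1) (hfin j).2
        have e2 := ENNReal.mul_ne_top (hwfin 2) (hfin j).1
        exact ENNReal.add_ne_top.2 ⟨ENNReal.add_ne_top.2 ⟨ENNReal.add_ne_top.2
          ⟨ih, ENNReal.mul_ne_top (by simp) e1⟩, ENNReal.mul_ne_top (by simp) e2⟩, hwfin 3⟩
      rw [← e, ENNReal.add_ne_top] at hrhs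
      exact hrhs.1
  have hmono : ∀ k, (∀ j, backMoment P B t k j ≠ ∞) →
      Monotone fun j => (backMoment P B t k j).toReal := fun k hk i j hij =>
    ENNReal.toReal_mono (hk j) (backMoment_mono B t k hij)
  have hloadR : lam * (workMoment P B 1).toReal < 1 := by
    have := ENNReal.toReal_strict_mono ENNReal.one_ne_top hload
    rwa [ENNReal.toReal_mul, ENNReal.toReal_ofReal hlam.le, ENNReal.toReal_one] at this
  have hlim := tendsto_of_moment_recursion (u := fun j => (backMoment P B t 1 j).toReal)
    (v := fun j => (backMoment P B t 2 j).toReal) (w := fun j => (backMoment P B t 3 j).toReal)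
    (d := (workMoment P B 3).toReal) hlam (ENNReal.toReal_nonneg (a := workMoment P B 1))
    (ENNReal.toReal_nonneg (a := workMoment P B 2)) hloadR
    (hmono 1 fun j => (hfin j).1) (hmono 2 fun j => (hfin j).2) (hmono 3 hfin3)
    (fun j => by
      have e := congrArg ENNReal.toReal (h.backMoment_two_succ hlam j)
      have n1 := hwfin 1
      have n2 := hwfin 2
      have n3 := hfin j
      have n4 := hfin (j + 1)
      rw [ENNReal.toReal_add n4.2 (ENNReal.mul_ne_top ENNReal.ofReal_ne_top n4.1),
        ENNReal.toReal_add (ENNReal.add_ne_top.2 ⟨n3.2, ENNReal.mul_ne_top (by simp)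
          (ENNReal.mul_ne_top n1 n3.1)⟩) n2,
        ENNReal.toReal_add n3.2 (ENNReal.mul_ne_top (by simp) (ENNReal.mul_ne_top n1 n3.1))] at e
      simpa [ENNReal.toReal_mul, ENNReal.toReal_ofReal (div_pos two_pos hlam).le] using e)
    (fun j => by
      have e := congrArg ENNReal.toReal (h.backMoment_three_succ hlam j)
      have n1 := hwfin 1
      have n2 := hwfin 2
      have n3 := hfin j
      have n4 := hfin (j + 1)
      have m1 : 3 * (workMoment P B 1 * backMoment P B t 2 j) ≠ ∞ :=
        ENNReal.mul_ne_top (by simp) (ENNReal.mul_ne_top n1 n3.2)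
      have m2 : 3 * (workMoment P B 2 * backMoment P B t 1 j) ≠ ∞ :=
        ENNReal.mul_ne_top (by simp) (ENNReal.mul_ne_top n2 n3.1)
      rw [ENNReal.toReal_add (hfin3 _) (ENNReal.mul_ne_top ENNReal.ofReal_ne_top n4.2),
        ENNReal.toReal_add (ENNReal.add_ne_top.2 ⟨ENNReal.add_ne_top.2 ⟨hfin3 j, m1⟩, m2⟩)
          (hwfin 3),
        ENNReal.toReal_add (ENNReal.add_ne_top.2 ⟨hfin3 j, m1⟩) m2,
        ENNReal.toReal_add (hfin3 j) m1] at e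
      simpa [ENNReal.toReal_mul, ENNReal.toReal_ofReal (div_pos three_pos hlam).le] using e)
  have hE := ENNReal.tendsto_ofReal hlim
  simp only [ENNReal.ofReal_toReal (hfin _).1] at hE
  have hgap : (0 : ℝ) < 1 - lam * (workMoment P B 1).toReal := by linarith
  rwa [ENNReal.ofReal_div_of_pos (by positivity), ENNReal.ofReal_mul hlam.le,
    ENNReal.ofReal_mul zero_le_two, ENNReal.ofReal_sub _ (by positivity),
    ENNReal.ofReal_mul hlam.le, ENNReal.ofReal_toReal (hwfin 1), ENNReal.ofReal_toReal (hwfin 2),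
    ENNReal.ofReal_one, ENNReal.ofReal_ofNat] at hE

lemma truncate (h : IsQueueInput P lam B t) (K : ℕ) :
    IsQueueInput P lam (fun i ω => min (B i ω) K) t where
  measurable_work i := (h.measurable_work i).min measurable_const
  measurable_time := h.measurable_time
  work_nonneg i ω := le_min (h.work_nonneg i ω) (Nat.cast_nonneg K)
  work_law i j := ((identDistrib_of_map_eq (h.measurable_work i) (h.measurable_work j)
    (h.work_law i j)).comp (u := fun x => min x (K : ℝ)) (by fun_prop)).map_eq
  time_law := h.time_law
  indep := by
    have := h.indep.comp (Sum.elim (fun _ x => min x (K : ℝ)) fun _ x => x) (by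
      rintro (i | i) <;> simp only [Sum.elim_inl, Sum.elim_inr] <;> fun_prop)
    convert! this using 1
    ext x ω
    cases x <;> rfl

lemma tendsto_min_natCast (x : ℝ) : Tendsto (fun K : ℕ => min x (K : ℝ)) atTop (𝓝 x) := by
  refine tendsto_const_nhds.congr' ?_
  filter_upwards [eventually_ge_atTop ⌈x⌉₊] with K hK
  exact (min_eq_left (Nat.ceil_le.1 hK)).symm

lemma monotone_min_natCast (x : ℝ) : Monotone fun K : ℕ => min x (K : ℝ) :=
  fun _ _ h => min_le_min le_rfl (Nat.cast_le.2 h)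

lemma tendsto_workMoment_truncate (h : IsQueueInput P lam B t) (k : ℕ) :
    Tendsto (fun K : ℕ => workMoment P (fun i ω => min (B i ω) (K : ℝ)) k) atTop
      (𝓝 (workMoment P B k)) := by
  have hB := h.measurable_work 0
  refine lintegral_tendsto_of_tendsto_of_monotone (fun K => by fun_prop) ?_ ?_
  · exact Eventually.of_forall fun ω K K' hK =>
      pow_le_pow_left' (ENNReal.ofReal_le_ofReal (monotone_min_natCast _ hK)) k
  · exact Eventually.of_forall fun ω =>
      ((ENNReal.continuous_pow k).tendsto _).comp
        (ENNReal.tendsto_ofReal (tendsto_min_natCast (B 0 ω)))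

lemma tendsto_backMoment_truncate (h : IsQueueInput P lam B t) (j : ℕ) :
    Tendsto (fun K : ℕ => backMoment P (fun i ω => min (B i ω) (K : ℝ)) t 1 j) atTop
      (𝓝 (backMoment P B t 1 j)) := by
  refine lintegral_tendsto_of_tendsto_of_monotone
    (fun K => (((h.truncate K).measurable_back j 0).ennreal_ofReal.pow_const 1).aemeasurable) ?_ ?_
  · exact Eventually.of_forall fun ω K K' hK =>
      pow_le_pow_left' (ENNReal.ofReal_le_ofReal
        (backlog_mono (fun i => monotone_min_natCast (B i ω) hK) _ _ _)) 1
  · exact Eventually.of_forall fun ω =>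
      ((ENNReal.continuous_pow 1).tendsto _).comp (ENNReal.tendsto_ofReal
        (tendsto_backlog (fun i => tendsto_min_natCast (B i ω)) _ _ _))

lemma monotone_backMoment_truncate (B t : ℕ → Ω → ℝ) (j : ℕ) :
    Monotone fun K : ℕ => backMoment P (fun i ω => min (B i ω) (K : ℝ)) t 1 j := by
  intro K K' hK
  exact lintegral_mono fun ω => pow_le_pow_left' (ENNReal.ofReal_le_ofReal
    (backlog_mono (fun i => monotone_min_natCast (B i ω) hK) _ _ _)) 1

/-- **Pollaczek–Khinchine formula**: the mean workload converges. -/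
lemma tendsto_backMoment (h : IsQueueInput P lam B t) (hlam : 0 < lam)
    (hload : ENNReal.ofReal lam * workMoment P B 1 < 1) :
    Tendsto (backMoment P B t 1) atTop (𝓝 (ENNReal.ofReal lam * workMoment P B 2
      / (2 * (1 - ENNReal.ofReal lam * workMoment P B 1)))) := by
  set T : ℕ → ℕ → Ω → ℝ := fun K i ω => min (B i ω) (K : ℝ) with hT
  have hle : ∀ K, workMoment P (T K) 1 ≤ workMoment P B 1 := fun K =>
    lintegral_mono fun ω => pow_le_pow_left' (ENNReal.ofReal_le_ofReal (min_le_left _ _)) 1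
  have hloadK : ∀ K, ENNReal.ofReal lam * workMoment P (T K) 1 < 1 := fun K =>
    (mul_le_mul_right (hle K) _).trans_lt hload
  have hK : ∀ K : ℕ, (⨆ j, backMoment P (T K) t 1 j) = ENNReal.ofReal lam * workMoment P (T K) 2
      / (2 * (1 - ENNReal.ofReal lam * workMoment P (T K) 1)) := fun K =>
    tendsto_nhds_unique (tendsto_atTop_iSup (backMoment_mono _ _ 1))
      ((h.truncate K).tendsto_backMoment_of_bounded hlam (K := K) (fun ω => min_le_right _ _)
        (hloadK K))
  have hj : ∀ j, backMoment P B t 1 j = ⨆ K, backMoment P (T K) t 1 j := fun j =>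
    tendsto_nhds_unique (h.tendsto_backMoment_truncate j)
      (tendsto_atTop_iSup (monotone_backMoment_truncate B t j))
  have hsup := tendsto_atTop_iSup (backMoment_mono (P := P) B t 1)
  convert! hsup using 2
  simp_rw [hj]
  -- Everything increases in both the number of jobs `j` and the truncation level `K`, so the two
  -- limits are suprema and commute.
  rw [iSup_comm]
  have hmonoK : Monotone fun K => ⨆ j, backMoment P (T K) t 1 j := fun K K' hKK =>
    iSup_mono fun j => monotone_backMoment_truncate B t j hKK
  refine tendsto_nhds_unique ?_ (tendsto_atTop_iSup hmonoK)
  simp_rw [hK]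
  -- The numerator may tend to `0` or to `∞`, so continuity of the division rests on the limit of
  -- the denominator being neither.
  have hgap : 1 - ENNReal.ofReal lam * workMoment P B 1 ≠ 0 := (tsub_pos_of_lt hload).ne'
  refine ENNReal.Tendsto.div (ENNReal.Tendsto.const_mul (h.tendsto_workMoment_truncate 2)
    (Or.inr ENNReal.ofReal_ne_top)) (Or.inr (mul_ne_zero two_ne_zero hgap))
    (ENNReal.Tendsto.const_mul (ENNReal.Tendsto.sub tendsto_const_nhds
      (ENNReal.Tendsto.const_mul (h.tendsto_workMoment_truncate 1)
        (Or.inr ENNReal.ofReal_ne_top)) (Or.inl ENNReal.one_ne_top)) (Or.inr (by simp)))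
    (Or.inl (ENNReal.mul_ne_top (by simp) (ENNReal.sub_ne_top ENNReal.one_ne_top)))

/-! ### Convergence of the backlog -/

/-- The stationary workload. -/
def limitBacklog (B t : ℕ → Ω → ℝ) (i : ℕ) (ω : Ω) : ℝ :=
  ⨆ j, backlog (fun k => B k ω) (fun k => t k ω) j i

lemma limitBacklog_nonneg (B t : ℕ → Ω → ℝ) (i : ℕ) (ω : Ω) : 0 ≤ limitBacklog B t i ω :=
  Real.iSup_nonneg fun _ => backlog_nonneg _ _ _ _

lemma measurable_limitBacklog (h : IsQueueInput P lam B t) (i : ℕ) :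
    Measurable (limitBacklog B t i) :=
  Measurable.iSup fun j => h.measurable_back j i

/-- If the load is below one then the backlog converges almost surely. -/
lemma ae_tendsto_backlog (h : IsQueueInput P lam B t) (hlam : 0 < lam)
    (hload : ENNReal.ofReal lam * workMoment P B 1 < 1) (i : ℕ) :
    ∀ᵐ ω ∂P, Tendsto (fun j => backlog (fun k => B k ω) (fun k => t k ω) j i) atTop
      (𝓝 (limitBacklog B t i ω)) := by
  have hlt : ENNReal.ofReal lam ≠ 0 := by simpa using hlam
  have hfin : workMoment P B 1 ≠ ∞ := fun htop => by
    rw [htop, ENNReal.mul_top hlt] at hload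
    exact not_top_lt hload
  have hB0 : Integrable (B 0) P := by
    refine ⟨(h.measurable_work 0).aestronglyMeasurable, ?_⟩
    rw [hasFiniteIntegral_iff_ofReal (Eventually.of_forall (h.work_nonneg 0))]
    simpa [workMoment] using hfin.lt_top
  have hEB : ∫ ω, B 0 ω ∂P = (workMoment P B 1).toReal := by
    rw [integral_eq_lintegral_of_nonneg_ae (Eventually.of_forall (h.work_nonneg 0))
      (h.measurable_work 0).aestronglyMeasurable]
    simp [workMoment]
  have hB : ∀ k, IdentDistrib (B k) (B 0) P P := fun k =>
    identDistrib_of_map_eq (h.measurable_work k) (h.measurable_work 0) (h.work_law k 0)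
  have hti : Integrable (t i) P ∧ ∫ ω, t i ω ∂P = 1 / lam := by
    have := integrable_id_expMeasure hlam
    rw [← h.time_law i] at this
    rw [integrable_map_measure (by fun_prop) (h.measurable_time i).aemeasurable,
      integral_map (h.measurable_time i).aemeasurable (by fun_prop)] at this
    exact this
  have hslln := strong_law_ae_real (μ := P) (fun l ω => B (i + l) ω - t (i + l) ω)
    (((hB i).integrable_iff.2 hB0).sub hti.1)
    (fun l l' hll => indepFun_of_disjoint h.measurable_elim h.indep
      (S := {x | Sum.elim id id x = i + l}) (T := {x | Sum.elim id id x = i + l'})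
      (Set.disjoint_left.2 fun x hx hx' => hll (by
        simp only [Set.mem_ofPred_eq] at hx hx'; omega))
      ((measurable_fst.sub measurable_snd).comp (measurable_work_pair B t (i + l)))
      ((measurable_fst.sub measurable_snd).comp (measurable_work_pair B t (i + l'))))
    (fun l => (h.identDistrib_pair h rfl (i + l) (i + 0)).comp (u := fun p : ℝ × ℝ => p.1 - p.2)
      (by fun_prop))
  have hneg : ∫ ω, (B (i + 0) ω - t (i + 0) ω) ∂P < 0 := by
    rw [add_zero, integral_sub ((hB i).integrable_iff.2 hB0) hti.1, hti.2, (hB i).integral_eq, hEB,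
      sub_neg, lt_div_iff₀ hlam]
    have := ENNReal.toReal_strict_mono ENNReal.one_ne_top hload
    rw [ENNReal.toReal_mul, ENNReal.toReal_ofReal hlam.le, ENNReal.toReal_one] at this
    linarith
  filter_upwards [hslln] with ω hω
  refine tendsto_atTop_ciSup (monotone_backlog _ _ i) ?_
  -- The averages tend to a negative mean, so the partial sums are eventually nonpositive. They are
  -- therefore bounded above, and so is the increasing backlog.
  have hev : ∀ᶠ k : ℕ in atTop, ∑ l ∈ Finset.range k, (B (i + l) ω - t (i + l) ω) ≤ 0 := by
    filter_upwards [hω.eventually_lt_const hneg, eventually_gt_atTop 0] with k hk hk0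
    have : (0 : ℝ) < k := Nat.cast_pos.2 hk0
    exact ((div_lt_iff₀ this).1 hk).le.trans (by simp)
  obtain ⟨C, hC⟩ : BddAbove (Set.range fun k =>
      ∑ l ∈ Finset.range k, (B (i + l) ω - t (i + l) ω)) :=
    (Filter.isBoundedUnder_of_eventually_le hev).bddAbove_range
  exact ⟨C, Set.forall_mem_range.2 fun j => backlog_le_of_sum_le _ _ j i C fun k =>
    hC (Set.mem_range_self k)⟩

/-- The mean of the stationary workload. -/
lemma lintegral_limitBacklog (h : IsQueueInput P lam B t) (hlam : 0 < lam)
    (hload : ENNReal.ofReal lam * workMoment P B 1 < 1) (i : ℕ) :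
    ∫⁻ ω, ENNReal.ofReal (limitBacklog B t i ω) ∂P
      = ENNReal.ofReal lam * workMoment P B 2
        / (2 * (1 - ENNReal.ofReal lam * workMoment P B 1)) := by
  refine tendsto_nhds_unique ?_ (h.tendsto_backMoment hlam hload)
  have hconv := lintegral_tendsto_of_tendsto_of_monotone (μ := P)
    (f := fun j ω => ENNReal.ofReal (backlog (fun k => B k ω) (fun k => t k ω) j i))
    (fun j => (h.measurable_back j i).ennreal_ofReal.aemeasurable)
    (Eventually.of_forall fun ω j j' hj => ENNReal.ofReal_le_ofReal (monotone_backlog _ _ i hj))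
    ((h.ae_tendsto_backlog hlam hload i).mono fun ω hω => ENNReal.tendsto_ofReal hω)
  refine hconv.congr fun j => ?_
  rw [← h.lintegral_backlog_pow 1 j i]
  simp

end IsQueueInput

/-! ### Reduction of the system to single queues -/

/-- The time that group `g` spends on a job with service times `x`. -/
def groupService {n m : ℕ} (grp : Fin n → Fin m) (g : Fin m) (x : Fin n → ℝ) : ℝ :=
  max 0 (⨅ s : group grp g, x s)

/-- The indicator of the choice of group `g`. -/
def chosen {m : ℕ} (g g' : Fin m) : ℝ := if g' = g then 1 else 0

lemma groupService_nonneg {n m : ℕ} (grp : Fin n → Fin m) (g : Fin m) (x : Fin n → ℝ) :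
    0 ≤ groupService grp g x := le_max_left _ _

lemma groupService_eq {n m : ℕ} (grp : Fin n → Fin m) (g : Fin m) {x : Fin n → ℝ}
    (hx : ∀ s, 0 ≤ x s) : groupService grp g x = ⨅ s : group grp g, x s :=
  max_eq_right (Real.iInf_nonneg fun s => hx s)

lemma measurable_groupService {n m : ℕ} (grp : Fin n → Fin m) (g : Fin m) :
    Measurable (groupService grp g) :=
  measurable_const.max (Measurable.iInf fun s => measurable_pi_apply (s : Fin n))

lemma chosen_nonneg {m : ℕ} (g g' : Fin m) : 0 ≤ chosen g g' := by
  unfold chosen; split_ifs <;> norm_num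

/-- The work that group `g` receives with a job. -/
def groupWork {n m : ℕ} (grp : Fin n → Fin m) (g : Fin m) (γ : ℕ → Fin m) (x : ℕ → Fin n → ℝ)
    (j : ℕ) : ℝ :=
  groupService grp g (x j) * chosen g (γ j)

lemma iInf_const_add {ι : Type*} [Finite ι] [Nonempty ι] (c : ℝ) (f : ι → ℝ) :
    ⨅ i, (c + f i) = c + ⨅ i, f i :=
  ((OrderIso.addLeft c).map_ciInf (Set.finite_range f).bddBelow).symm

section SamplePath

variable {n m : ℕ} {grp : Fin n → Fin m} {a : ℕ → ℝ} {γ : ℕ → Fin m} {x : ℕ → Fin n → ℝ}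

/-- All servers of a group are released by the earlier jobs at the same time. -/
lemma start_eq (hgrp : ∀ g, (group grp g).Nonempty) (ha : Monotone a) (ha0 : 0 ≤ a 0)
    (hx : ∀ j s, 0 ≤ x j s) (j : ℕ) : ∀ s,
    start a (fun i => group grp (γ i)) x j s
      = a j + workload (groupWork grp (grp s) γ x) (fun i => a (i + 1) - a i) j := by
  induction j with
  | zero => intro s; simp [start, free, workload, ha0]
  | succ j ih =>
    intro s
    have hs := ih s
    have hmono := ha j.le_succ
    simp only [Nat.succ_eq_add_one] at hmono
    have hmem : s ∈ group grp (γ j) ↔ γ j = grp s := by simp [group, eq_comm]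
    have hw := groupService_nonneg grp (grp s) (x j)
    by_cases h : γ j = grp s
    · have : Nonempty (group grp (γ j)) := (hgrp _).to_subtype
      have hfin : finish (a j) (group grp (γ j)) (x j)
          (free a (fun i => group grp (γ i)) x j)
          = a j + workload (groupWork grp (grp s) γ x) (fun i => a (i + 1) - a i) j
            + groupService grp (grp s) (x j) := by
        rw [groupService_eq _ _ (hx j), ← h, ← iInf_const_add]
        refine iInf_congr fun s' => ?_
        have hs' : grp s' = γ j := by simpa [group] using s'.2
        have := ih s'
        rw [hs'] at this
        rw [← this, start]
      have hle : free a (fun i => group grp (γ i)) x j s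
          ≤ a j + workload (groupWork grp (grp s) γ x) (fun i => a (i + 1) - a i) j := by
        rw [← hs]; exact le_max_right _ _
      rw [start, free, if_pos (hmem.2 h), hfin,
        max_eq_right (hle.trans (le_add_of_nonneg_right hw)), workload]
      have hgw : groupWork grp (grp s) γ x j = groupService grp (grp s) (x j) := by
        simp [groupWork, chosen, h]
      rw [hgw, ← max_add_add_left]
      congr 1 <;> ring
    · rw [start, free, if_neg (fun hc => h (hmem.1 hc)), workload]
      have hgw : groupWork grp (grp s) γ x j = 0 := by
        simp [groupWork, chosen, h]
      rw [start] at hs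
      -- Writing `a (j + 1)` as `max (a (j + 1)) (a j)` makes the start time of job `j` appear, to
      -- which the induction hypothesis applies.
      rw [hgw, ← max_eq_left hmono, max_assoc, hs, ← max_add_add_left, max_eq_left hmono]
      congr 1 <;> ring

lemma completion_eq (hgrp : ∀ g, (group grp g).Nonempty) (ha : Monotone a) (ha0 : 0 ≤ a 0)
    (hx : ∀ j s, 0 ≤ x j s) (j : ℕ) :
    completion a (fun i => group grp (γ i)) x j
      = a j + workload (groupWork grp (γ j) γ x) (fun i => a (i + 1) - a i) j
        + groupService grp (γ j) (x j) := by
  have : Nonempty (group grp (γ j)) := (hgrp _).to_subtype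
  rw [groupService_eq _ _ (hx j), ← iInf_const_add]
  refine iInf_congr fun s => ?_
  have hs : grp s = γ j := by simpa [group] using s.2
  rw [start_eq hgrp ha ha0 hx, hs]

lemma latency_eq (hgrp : ∀ g, (group grp g).Nonempty) (ha : Monotone a) (ha0 : 0 ≤ a 0)
    (hx : ∀ j s, 0 ≤ x j s) (j : ℕ) :
    latency a (fun i => group grp (γ i)) x j
      = groupService grp (γ j) (x j)
        + workload (groupWork grp (γ j) γ x) (fun i => a (i + 1) - a i) j := by
  rw [latency, completion_eq hgrp ha ha0 hx]
  ring

lemma cost_eq (hgrp : ∀ g, (group grp g).Nonempty) (ha : Monotone a) (ha0 : 0 ≤ a 0)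
    (hx : ∀ j s, 0 ≤ x j s) (j : ℕ) :
    cost a (fun i => group grp (γ i)) x j
      = (group grp (γ j)).card * groupService grp (γ j) (x j) := by
  rw [cost, ← nsmul_eq_mul, ← Finset.sum_const]
  refine Finset.sum_congr rfl fun s hs => ?_
  have hs : grp s = γ j := by simpa [group] using hs
  rw [completion_eq hgrp ha ha0 hx, start_eq hgrp ha ha0 hx, hs, add_sub_cancel_left,
    max_eq_left (groupService_nonneg _ _ _)]

end SamplePath

/-! ### Laws in the system -/

/-- The law of the minimum of `r` i.i.d. service times. -/
def minLaw (F : Measure ℝ) (r : ℕ) : Measure ℝ :=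
  (Measure.pi fun _ : Fin r => F).map fun x => max 0 (⨅ i, x i)

/-- The `max 0` built into `minLaw` makes works nonnegative on every sample path; since service
times are almost surely nonnegative, it does not affect the moments. -/
lemma lintegral_minLaw {F : Measure ℝ} [IsProbabilityMeasure F] (hF : F (Set.Iic 0) = 0)
    (r k : ℕ) : ∫⁻ x, ENNReal.ofReal x ^ k ∂(minLaw F r) = minMoment F r k := by
  have hm : Measurable fun x : Fin r → ℝ => max 0 (⨅ i, x i) :=
    measurable_const.max (Measurable.iInf fun s => measurable_pi_apply s)
  rw [minLaw, lintegral_map (by fun_prop) hm, minMoment]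
  have hpos : ∀ᵐ x ∂(Measure.pi fun _ : Fin r => F), ∀ i, 0 ≤ x i := by
    rw [ae_all_iff]
    intro i
    have hFae : ∀ᵐ y ∂F, 0 ≤ y := by
      rw [ae_iff]
      exact measure_mono_null (fun y hy => (not_le.1 hy).le) hF
    exact (Measure.quasiMeasurePreserving_eval (μ := fun _ : Fin r => F) i).ae hFae
  refine lintegral_congr_ae (hpos.mono fun x hx => ?_)
  have h0 : 0 ≤ ⨅ i, x i := Real.iInf_nonneg hx
  simp only
  rw [max_eq_right h0, ENNReal.ofReal_pow h0]

namespace IsGroupBasedSystem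

variable {Ω : Type*} [MeasurableSpace Ω] {P : Measure Ω} [IsProbabilityMeasure P] {F : Measure ℝ}
  [IsProbabilityMeasure F] {n m r : ℕ} {grp : Fin n → Fin m} {A : ℕ → Ω → ℝ} {G : ℕ → Ω → Fin m}
  {X : ℕ → Fin n → Ω → ℝ}

lemma measurable_service_group (h : IsGroupBasedSystem P F r grp A G X) (g : Fin m) (j : ℕ) :
    Measurable fun ω => groupService grp g (fun s => X j s ω) :=
  (measurable_groupService grp g).comp (measurable_pi_lambda _ fun s => h.measurable_service j s)

lemma measurable_chosen (h : IsGroupBasedSystem P F r grp A G X) (g : Fin m) (j : ℕ) :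
    Measurable fun ω => chosen g (G j ω) :=
  (measurable_of_finite (chosen g)).comp (h.measurable_choice j)

lemma map_groupService (h : IsGroupBasedSystem P F r grp A G X) (g : Fin m) (j : ℕ) :
    P.map (fun ω => groupService grp g (fun s => X j s ω)) = minLaw F r := by
  let e : Fin r ≃ group grp g := (Finset.equivFinOfCardEq (h.card_group g)).symm
  have hind : iIndepFun (fun i : Fin r => X j (e i)) P :=
    h.service_indep.precomp (g := fun i : Fin r => (j, (e i : Fin n))) fun i i' hii => by
      simpa [Subtype.ext_iff] using hii
  have hmap := (iIndepFun_iff_map_fun_eq_pi_map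
    fun i => (h.measurable_service j (e i)).aemeasurable).1 hind
  simp_rw [h.service_law] at hmap
  rw [minLaw, ← hmap, Measure.map_map
    (measurable_const.max (Measurable.iInf fun s => measurable_pi_apply s))
    (measurable_pi_lambda _ fun i => h.measurable_service j (e i))]
  congr 1
  ext ω
  simp only [groupService, Function.comp_apply]
  rw [← e.iInf_comp]

/-- What matters is that the right side depends on neither `g` nor `j`. -/
lemma map_chosen (h : IsGroupBasedSystem P F r grp A G X) (g : Fin m) (j : ℕ) :
    P.map (fun ω => chosen g (G j ω))
      = (m : ℝ≥0∞)⁻¹ • Measure.dirac 1 + (1 - (m : ℝ≥0∞)⁻¹) • Measure.dirac 0 := by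
  have hms := h.measurable_choice j (measurableSet_singleton g)
  ext s hs
  rw [Measure.map_apply (h.measurable_chosen g j) hs]
  have hcompl : P (G j ⁻¹' {g})ᶜ = 1 - (m : ℝ≥0∞)⁻¹ := by
    rw [prob_compl_eq_one_sub hms, h.choice_uniform]
  have hle : (m : ℝ≥0∞)⁻¹ ≤ 1 := by
    rw [← h.choice_uniform j g]; exact prob_le_one
  have hpre : (fun ω => chosen g (G j ω)) ⁻¹' s
      = {ω | (G j ω = g ∧ (1 : ℝ) ∈ s) ∨ (G j ω ≠ g ∧ (0 : ℝ) ∈ s)} := by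
    ext ω
    by_cases hg : G j ω = g <;> simp [chosen, hg]
  rw [hpre]
  by_cases h1 : (1 : ℝ) ∈ s <;> by_cases h0 : (0 : ℝ) ∈ s
  · have : {ω | (G j ω = g ∧ (1 : ℝ) ∈ s) ∨ (G j ω ≠ g ∧ (0 : ℝ) ∈ s)} = Set.univ := by
      ext ω; simp [h1, h0, em]
    rw [this]
    simp [h1, h0, hs, add_tsub_cancel_of_le hle]
  · have : {ω | (G j ω = g ∧ (1 : ℝ) ∈ s) ∨ (G j ω ≠ g ∧ (0 : ℝ) ∈ s)} = G j ⁻¹' {g} := by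
      ext ω; simp [h1, h0]
    rw [this, h.choice_uniform]
    simp [h1, h0, hs]
  · have : {ω | (G j ω = g ∧ (1 : ℝ) ∈ s) ∨ (G j ω ≠ g ∧ (0 : ℝ) ∈ s)} = (G j ⁻¹' {g})ᶜ := by
      ext ω; simp [h1, h0]
    rw [this, hcompl]
    simp [h1, h0, hs]
  · have : {ω | (G j ω = g ∧ (1 : ℝ) ∈ s) ∨ (G j ω ≠ g ∧ (0 : ℝ) ∈ s)} = ∅ := by
      ext ω; simp [h1, h0]
    rw [this]
    simp [h1, h0, hs]

lemma indepFun_choice_service (h : IsGroupBasedSystem P F r grp A G X) (g : Fin m) (j : ℕ) :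
    IndepFun (G j) (fun ω => groupService grp g (fun s => X j s ω)) P :=
  h.choice_indep_service.comp (φ := fun f : ℕ → Fin m => f j)
    (ψ := fun f : ℕ → Fin n → ℝ => groupService grp g (f j))
    (measurable_pi_apply j) ((measurable_groupService grp g).comp (measurable_pi_apply j))

/-- The sample paths are regular almost surely. -/
lemma ae_regular (h : IsGroupBasedSystem P F r grp A G X) (hF : F (Set.Iic 0) = 0) :
    ∀ᵐ ω ∂P, (Monotone fun j => A j ω) ∧ 0 ≤ A 0 ω ∧ ∀ j s, 0 ≤ X j s ω := by
  have hX : ∀ᵐ ω ∂P, ∀ j s, 0 ≤ X j s ω := by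
    rw [ae_all_iff]
    intro j
    rw [ae_all_iff]
    intro s
    have hFae : ∀ᵐ y ∂(P.map (X j s)), 0 ≤ y := by
      rw [h.service_law, ae_iff]
      exact measure_mono_null (fun y hy => (not_le.1 hy).le) hF
    exact ae_of_ae_map (h.measurable_service j s).aemeasurable hFae
  filter_upwards [h.arrival_mono, h.arrival_nonneg, hX] with ω h1 h2 h3 using ⟨h1, h2, h3⟩

lemma group_nonempty (h : IsGroupBasedSystem P F r grp A G X) (hr : 0 < r) (g : Fin m) :
    (group grp g).Nonempty :=
  Finset.card_pos.1 (by rw [h.card_group]; exact hr)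

lemma measurable_jobService (h : IsGroupBasedSystem P F r grp A G X) (j : ℕ) :
    Measurable fun ω => groupService grp (G j ω) (fun s => X j s ω) :=
  measurable_select (h.measurable_choice j)
    (Y := fun g ω => groupService grp g (fun s => X j s ω)) fun g => h.measurable_service_group g j

lemma map_jobService (h : IsGroupBasedSystem P F r grp A G X) (j : ℕ) :
    P.map (fun ω => groupService grp (G j ω) (fun s => X j s ω)) = minLaw F r :=
  map_select (h.measurable_choice j)
    (Y := fun g ω => groupService grp g (fun s => X j s ω))
    (fun g => h.measurable_service_group g j)
    (fun g _ hs => (h.indepFun_choice_service g j).measure_inter_preimage_eq_mul _ _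
      (measurableSet_singleton g) hs) (fun g => h.map_groupService g j)

/-- The expected cost of a job. -/
lemma lintegral_groupCost (h : IsGroupBasedSystem P F r grp A G X) (hF : F (Set.Iic 0) = 0)
    (hr : 0 < r) (j : ℕ) :
    ∫⁻ ω, ENNReal.ofReal (groupCost grp A G X j ω) ∂P = r * minMoment F r 1 := by
  have hcost : ∀ᵐ ω ∂P, ENNReal.ofReal (groupCost grp A G X j ω)
      = r * ENNReal.ofReal (groupService grp (G j ω) (fun s => X j s ω)) := by
    filter_upwards [h.ae_regular hF] with ω hω
    rw [groupCost, cost_eq (γ := fun i => G i ω) (h.group_nonempty hr) hω.1 hω.2.1 hω.2.2,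
      h.card_group, ENNReal.ofReal_mul (Nat.cast_nonneg r), ENNReal.ofReal_natCast]
  have hm := h.measurable_jobService j
  rw [lintegral_congr_ae hcost, lintegral_const_mul _ hm.ennreal_ofReal, ← lintegral_minLaw hF r 1,
    ← h.map_jobService j]
  simp only [pow_one]
  rw [lintegral_map ENNReal.measurable_ofReal hm]

end IsGroupBasedSystem

namespace IsGroupBasedSystem

variable {Ω : Type*} [MeasurableSpace Ω] {P : Measure Ω} [IsProbabilityMeasure P] {F : Measure ℝ}
  [IsProbabilityMeasure F] {n m r : ℕ} {grp : Fin n → Fin m} {A : ℕ → Ω → ℝ} {G : ℕ → Ω → Fin m}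
  {X : ℕ → Fin n → Ω → ℝ} {lam : ℝ}

/-! ### The inputs of the queue of one group -/

/-- The service time of job `j` in group `g`. -/
def service (grp : Fin n → Fin m) (X : ℕ → Fin n → Ω → ℝ) (g : Fin m) (j : ℕ) (ω : Ω) : ℝ :=
  groupService grp g (fun s => X j s ω)

lemma service_nonneg (grp : Fin n → Fin m) (X : ℕ → Fin n → Ω → ℝ) (g : Fin m) (j : ℕ) (ω : Ω) :
    0 ≤ service grp X g j ω := groupService_nonneg _ _ _

/-- The indicator that job `j` is forked to group `g`. -/
def choice (G : ℕ → Ω → Fin m) (g : Fin m) (j : ℕ) (ω : Ω) : ℝ := chosen g (G j ω)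

/-- The time between jobs `j` and `j + 1`. -/
def gap (A : ℕ → Ω → ℝ) (j : ℕ) (ω : Ω) : ℝ := A (j + 1) ω - A j ω

/-- The work that job `j` brings to group `g`. -/
def work (grp : Fin n → Fin m) (G : ℕ → Ω → Fin m) (X : ℕ → Fin n → Ω → ℝ) (g : Fin m) (j : ℕ)
    (ω : Ω) : ℝ := service grp X g j ω * choice G g j ω

/-- All random inputs of the queue of group `g`. -/
def inputs (grp : Fin n → Fin m) (A : ℕ → Ω → ℝ) (G : ℕ → Ω → Fin m) (X : ℕ → Fin n → Ω → ℝ)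
    (g : Fin m) : (ℕ ⊕ ℕ) ⊕ ℕ → Ω → ℝ :=
  Sum.elim (Sum.elim (service grp X g) (choice G g)) (gap A)

lemma measurable_gap (h : IsGroupBasedSystem P F r grp A G X) (j : ℕ) : Measurable (gap A j) :=
  (h.measurable_arrival (j + 1)).sub (h.measurable_arrival j)

lemma measurable_inputs (h : IsGroupBasedSystem P F r grp A G X) (g : Fin m) (x : (ℕ ⊕ ℕ) ⊕ ℕ) :
    Measurable (inputs grp A G X g x) := by
  rcases x with (j | j) | j
  · exact h.measurable_service_group g j
  · exact h.measurable_chosen g j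
  · exact h.measurable_gap j

lemma indep_service (h : IsGroupBasedSystem P F r grp A G X) (g : Fin m) :
    iIndepFun (service grp X g) P :=
  (iIndepFun_rows h.measurable_service h.service_indep).comp (fun _ => groupService grp g)
    fun _ => measurable_groupService grp g

lemma indep_choice (h : IsGroupBasedSystem P F r grp A G X) (g : Fin m) :
    iIndepFun (choice G g) P :=
  h.choice_indep.comp (fun _ => chosen g) fun _ => measurable_of_finite _

lemma indep_service_choice (h : IsGroupBasedSystem P F r grp A G X) (g : Fin m) :
    iIndepFun (Sum.elim (service grp X g) (choice G g)) P :=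
  iIndepFun_sumElim (h.indep_service g) (h.indep_choice g)
    (h.choice_indep_service.symm.comp
      (φ := fun (f : ℕ → Fin n → ℝ) j => groupService grp g (f j))
      (ψ := fun (f : ℕ → Fin m) j => chosen g (f j))
      (measurable_pi_lambda _ fun j =>
        (measurable_groupService grp g).comp (measurable_pi_apply j))
      (measurable_pi_lambda _ fun j =>
        (measurable_of_finite (chosen g)).comp (measurable_pi_apply j)))

lemma indep_gap (hpois : IsPoissonArrivals P lam A) : iIndepFun (gap A) P :=
  hpois.indep.precomp (g := Nat.succ) Nat.succ_injective

lemma indepFun_arrival (h : IsGroupBasedSystem P F r grp A G X) {ι : Type*}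
    {f : (ℕ → Fin m) × (ℕ → Fin n → ℝ) → ι → ℝ} (hf : Measurable f) :
    IndepFun (fun ω => f (fun j => G j ω, fun j s => X j s ω)) (fun ω j => gap A j ω) P :=
  h.arrival_indep.symm.comp (φ := f) (ψ := fun (a : ℕ → ℝ) j => a (j + 1) - a j) hf
    (measurable_pi_lambda _ fun j => (measurable_pi_apply (j + 1)).sub (measurable_pi_apply j))

lemma measurable_service_of_path (grp : Fin n → Fin m) (g : Fin m) (j : ℕ) :
    Measurable fun p : (ℕ → Fin m) × (ℕ → Fin n → ℝ) => groupService grp g (p.2 j) :=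
  (measurable_groupService grp g).comp ((measurable_pi_apply j).comp measurable_snd)

lemma measurable_choice_of_path (g : Fin m) (j : ℕ) :
    Measurable fun p : (ℕ → Fin m) × (ℕ → Fin n → ℝ) => chosen g (p.1 j) :=
  (measurable_of_finite (chosen g)).comp ((measurable_pi_apply j).comp measurable_fst)

lemma indep_inputs (h : IsGroupBasedSystem P F r grp A G X) (hpois : IsPoissonArrivals P lam A)
    (g : Fin m) : iIndepFun (inputs grp A G X g) P := by
  refine iIndepFun_sumElim (h.indep_service_choice g) (indep_gap hpois) ?_
  have := h.indepFun_arrival (f := fun p => Sum.elim (fun j => groupService grp g (p.2 j))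
    fun j => chosen g (p.1 j)) (measurable_pi_lambda _ fun x => by
      cases x with
      | inl j => exact measurable_service_of_path grp g j
      | inr j => exact measurable_choice_of_path g j)
  convert! this using 1
  ext ω x
  cases x <;> rfl

/-- Arrange the services and choices as rows of two entries, one row per job; each work is a
function of its own row. -/
lemma indep_work (h : IsGroupBasedSystem P F r grp A G X) (g : Fin m) :
    iIndepFun (work grp G X g) P := by
  let V : ℕ → Bool → Ω → ℝ := fun j b => cond b (service grp X g j) (choice G g j)
  have hV : iIndepFun (fun p : ℕ × Bool => V p.1 p.2) P := by
    have := (h.indep_service_choice g).precomp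
      (g := fun p : ℕ × Bool => cond p.2 (Sum.inl p.1) (Sum.inr p.1)) (by
        rintro ⟨j, b⟩ ⟨j', b'⟩ hjj
        cases b <;> cases b' <;> simp_all)
    convert! this using 1
    ext ⟨j, b⟩ ω
    cases b <;> rfl
  have hmV : ∀ j b, Measurable (V j b) := by
    rintro j (_ | _)
    · exact h.measurable_chosen g j
    · exact h.measurable_service_group g j
  exact (iIndepFun_rows hmV hV).comp (fun _ (f : Bool → ℝ) => f true * f false)
    fun _ => by fun_prop

lemma indepFun_service_choice (h : IsGroupBasedSystem P F r grp A G X) (g : Fin m) (j : ℕ) :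
    IndepFun (service grp X g j) (choice G g j) P :=
  (h.indep_service_choice g).indepFun (i := Sum.inl j) (j := Sum.inr j) (by simp)

lemma map_work (h : IsGroupBasedSystem P F r grp A G X) (g g' : Fin m) (j j' : ℕ) :
    P.map (work grp G X g j) = P.map (work grp G X g' j') :=
  (((identDistrib_of_map_eq (h.measurable_service_group g j) (h.measurable_service_group g' j')
    (by rw [h.map_groupService, h.map_groupService])).prodMk
    (identDistrib_of_map_eq (h.measurable_chosen g j) (h.measurable_chosen g' j')
      (by rw [h.map_chosen, h.map_chosen]))
    (h.indepFun_service_choice g j) (h.indepFun_service_choice g' j')).comp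
    (u := fun p : ℝ × ℝ => p.1 * p.2) (by fun_prop)).map_eq

/-- Jobs forked to other groups enter with work zero, so the interarrival times are those of the
full stream, with rate `lam`. The index shift in `time_law` is due to `interarrival A 0` being the
time before job `0`. -/
lemma isQueueInput (h : IsGroupBasedSystem P F r grp A G X) (hpois : IsPoissonArrivals P lam A)
    (g : Fin m) : IsQueueInput P lam (work grp G X g) (gap A) where
  measurable_work j := (h.measurable_service_group g j).mul (h.measurable_chosen g j)
  measurable_time := h.measurable_gap
  work_nonneg _ _ := mul_nonneg (groupService_nonneg _ _ _) (chosen_nonneg _ _)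
  work_law := h.map_work g g
  time_law j := hpois.law (j + 1)
  indep := iIndepFun_sumElim (h.indep_work g) (indep_gap hpois)
    (h.indepFun_arrival (f := fun p j => groupService grp g (p.2 j) * chosen g (p.1 j))
      (measurable_pi_lambda _ fun j =>
        (measurable_service_of_path grp g j).mul (measurable_choice_of_path g j)))

lemma lintegral_service (h : IsGroupBasedSystem P F r grp A G X) (hF : F (Set.Iic 0) = 0)
    (g : Fin m) (j k : ℕ) :
    ∫⁻ ω, ENNReal.ofReal (service grp X g j ω) ^ k ∂P = minMoment F r k := by
  have hm : Measurable (service grp X g j) := h.measurable_service_group g j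
  have hmap : P.map (service grp X g j) = minLaw F r := h.map_groupService g j
  rw [← lintegral_minLaw hF r k, ← hmap, lintegral_map (by fun_prop) hm]

lemma workMoment_work (h : IsGroupBasedSystem P F r grp A G X) (hF : F (Set.Iic 0) = 0)
    (g : Fin m) {k : ℕ} (hk : k ≠ 0) :
    IsQueueInput.workMoment P (work grp G X g) k = minMoment F r k * (m : ℝ≥0∞)⁻¹ := by
  have hm : Measurable (service grp X g 0) := h.measurable_service_group g 0
  have hc : Measurable (choice G g 0) := h.measurable_chosen g 0
  have hcm : ∫⁻ ω, ENNReal.ofReal (choice G g 0 ω) ^ k ∂P = (m : ℝ≥0∞)⁻¹ := by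
    rw [← h.choice_uniform 0 g, ← lintegral_indicator_one
      (h.measurable_choice 0 (measurableSet_singleton g))]
    refine lintegral_congr fun ω => ?_
    by_cases hg : G 0 ω = g <;> simp [choice, chosen, hg, hk]
  rw [← h.lintegral_service hF g 0 k, ← hcm, IsQueueInput.workMoment]
  have := lintegral_mul_eq_lintegral_mul_lintegral_of_indepFun (μ := P)
    (hm.ennreal_ofReal.pow_const k) (hc.ennreal_ofReal.pow_const k)
    ((h.indepFun_service_choice g 0).comp
      (φ := fun x => ENNReal.ofReal x ^ k) (ψ := fun x => ENNReal.ofReal x ^ k)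
      (by fun_prop) (by fun_prop))
  rw [← this]
  refine lintegral_congr fun ω => ?_
  simp only [Pi.mul_apply, work]
  rw [ENNReal.ofReal_mul (service_nonneg grp X g 0 ω), mul_pow]

/-! ### The latency -/

/-- The latency of job `j` if it is forked to group `g`. -/
def latencyIn (grp : Fin n → Fin m) (A : ℕ → Ω → ℝ) (G : ℕ → Ω → Fin m) (X : ℕ → Fin n → Ω → ℝ)
    (j : ℕ) (g : Fin m) (ω : Ω) : ℝ :=
  service grp X g j ω + workload (fun k => work grp G X g k ω) (fun k => gap A k ω) j

/-- A variable with the law of the latency of job `j` that increases with `j`. -/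
def monotoneLatency (grp : Fin n → Fin m) (A : ℕ → Ω → ℝ) (G : ℕ → Ω → Fin m)
    (X : ℕ → Fin n → Ω → ℝ) (g : Fin m) (j : ℕ) (ω : Ω) : ℝ :=
  service grp X g 0 ω + backlog (fun k => work grp G X g k ω) (fun k => gap A k ω) j 1

lemma groupLatency_ae_eq (h : IsGroupBasedSystem P F r grp A G X) (hF : F (Set.Iic 0) = 0)
    (hr : 0 < r) (j : ℕ) :
    groupLatency grp A G X j =ᵐ[P] fun ω => latencyIn grp A G X j (G j ω) ω := by
  filter_upwards [h.ae_regular hF] with ω hω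
  rw [groupLatency, latency_eq (γ := fun i => G i ω) (h.group_nonempty hr) hω.1 hω.2.1 hω.2.2]
  rfl

lemma measurable_work_of {S : Set ((ℕ ⊕ ℕ) ⊕ ℕ)} (g : Fin m) {k : ℕ}
    (h1 : Sum.inl (Sum.inl k) ∈ S) (h2 : Sum.inl (Sum.inr k) ∈ S) :
    Measurable[sigmaOf (inputs grp A G X g) S] (work grp G X g k) :=
  (measurable_sigmaOf (Z := inputs grp A G X g) h1).mul
    (measurable_sigmaOf (Z := inputs grp A G X g) h2)

lemma measurable_workload_of {S : Set ((ℕ ⊕ ℕ) ⊕ ℕ)} (g : Fin m) {j : ℕ}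
    (hS : ∀ k < j, Sum.inl (Sum.inl k) ∈ S ∧ Sum.inl (Sum.inr k) ∈ S ∧ Sum.inr k ∈ S) :
    Measurable[sigmaOf (inputs grp A G X g) S]
      fun ω => workload (fun k => work grp G X g k ω) (fun k => gap A k ω) j :=
  measurable_workload (fun k hk => measurable_work_of g (hS k hk).1 (hS k hk).2.1)
    fun k hk => measurable_sigmaOf (Z := inputs grp A G X g) (hS k hk).2.2

lemma measurable_latencyIn (h : IsGroupBasedSystem P F r grp A G X) (j : ℕ) (g : Fin m) :
    Measurable (latencyIn grp A G X j g) :=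
  (h.measurable_service_group g j).add (measurable_workload
    (fun k _ => (h.measurable_service_group g k).mul (h.measurable_chosen g k))
    fun k _ => h.measurable_gap k)

/-- The workload found by job `j` involves the choices of earlier jobs only. -/
lemma indepFun_choice_latencyIn (h : IsGroupBasedSystem P F r grp A G X)
    (hpois : IsPoissonArrivals P lam A) (j : ℕ) (g : Fin m) :
    IndepFun (choice G g j) (latencyIn grp A G X j g) P :=
  indepFun_of_disjoint (h.measurable_inputs g) (h.indep_inputs hpois g)
    (S := {Sum.inl (Sum.inr j)}) (T := {Sum.inl (Sum.inr j)}ᶜ) disjoint_compl_right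
    (measurable_sigmaOf (Z := inputs grp A G X g) (i := Sum.inl (Sum.inr j)) rfl)
    (Measurable.add
      (measurable_sigmaOf (Z := inputs grp A G X g) (i := Sum.inl (Sum.inl j)) (by simp))
      (measurable_workload_of g fun k hk => by simp [hk.ne]))

lemma indepFun_service_workload (h : IsGroupBasedSystem P F r grp A G X)
    (hpois : IsPoissonArrivals P lam A) (j : ℕ) (g : Fin m) :
    IndepFun (service grp X g j)
      (fun ω => workload (fun k => work grp G X g k ω) (fun k => gap A k ω) j) P :=
  indepFun_of_disjoint (h.measurable_inputs g) (h.indep_inputs hpois g)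
    (S := {Sum.inl (Sum.inl j)}) (T := {Sum.inl (Sum.inl j)}ᶜ) disjoint_compl_right
    (measurable_sigmaOf (Z := inputs grp A G X g) (i := Sum.inl (Sum.inl j)) rfl)
    (measurable_workload_of g fun k hk => by simp [hk.ne])

/-- Starting the backlog at index `1` leaves job `0` free to supply an independent service time. -/
lemma indepFun_service_backlog (h : IsGroupBasedSystem P F r grp A G X)
    (hpois : IsPoissonArrivals P lam A) (j : ℕ) (g : Fin m) :
    IndepFun (service grp X g 0)
      (fun ω => backlog (fun k => work grp G X g k ω) (fun k => gap A k ω) j 1) P :=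
  indepFun_of_disjoint (h.measurable_inputs g) (h.indep_inputs hpois g)
    (S := {Sum.inl (Sum.inl 0)}) (T := {Sum.inl (Sum.inl 0)}ᶜ) disjoint_compl_right
    (measurable_sigmaOf (Z := inputs grp A G X g) (i := Sum.inl (Sum.inl 0)) rfl)
    (measurable_backlog j 1
      (fun k hk => measurable_work_of g (by simp; omega) (by simp))
      fun k _ => measurable_sigmaOf (Z := inputs grp A G X g) (i := Sum.inr k) (by simp))

lemma identDistrib_monotoneLatency (h : IsGroupBasedSystem P F r grp A G X)
    (hpois : IsPoissonArrivals P lam A) (j : ℕ) (g g' : Fin m) :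
    IdentDistrib (monotoneLatency grp A G X g j) (latencyIn grp A G X j g') P P :=
  ((identDistrib_of_map_eq (h.measurable_service_group g 0) (h.measurable_service_group g' j)
    (by rw [h.map_groupService, h.map_groupService])).prodMk
    ((h.isQueueInput hpois g).identDistrib_backlog_workload (h.isQueueInput hpois g')
      (h.map_work g g' 0 0) j 1)
    (h.indepFun_service_backlog hpois j g) (h.indepFun_service_workload hpois j g')).comp
    (u := fun p : ℝ × ℝ => p.1 + p.2) (by fun_prop)

lemma identDistrib_groupLatency (h : IsGroupBasedSystem P F r grp A G X)
    (hF : F (Set.Iic 0) = 0) (hr : 0 < r) (hpois : IsPoissonArrivals P lam A) (g : Fin m) (j : ℕ) :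
    IdentDistrib (monotoneLatency grp A G X g j) (groupLatency grp A G X j) P P := by
  have hae := h.groupLatency_ae_eq hF hr j
  have hm := measurable_select (h.measurable_choice j) (h.measurable_latencyIn j)
  refine ⟨(h.identDistrib_monotoneLatency hpois j g g).aemeasurable_fst,
    hm.aemeasurable.congr hae.symm, ?_⟩
  rw [Measure.map_congr hae]
  refine (map_select (h.measurable_choice j) (h.measurable_latencyIn j) (fun g' s hs => ?_)
    fun g' => (h.identDistrib_monotoneLatency hpois j g g').map_eq.symm).symm
  -- Only the real-valued indicator of the choice belongs to the independent family `inputs`.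
  have hpre : G j ⁻¹' {g'} = choice G g' j ⁻¹' {1} := by
    ext ω
    by_cases hg : G j ω = g' <;> simp [choice, chosen, hg]
  rw [hpre]
  exact (h.indepFun_choice_latencyIn hpois j g').measure_inter_preimage_eq_mul _ _
    (measurableSet_singleton 1) hs

/-- The stationary latency. -/
def limitLatency (grp : Fin n → Fin m) (A : ℕ → Ω → ℝ) (G : ℕ → Ω → Fin m)
    (X : ℕ → Fin n → Ω → ℝ) (g : Fin m) (ω : Ω) : ℝ :=
  service grp X g 0 ω + IsQueueInput.limitBacklog (work grp G X g) (gap A) 1 ω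

/-- Both parts are a scaling by `m * r`, which is neither `0` nor `∞` and so may be cancelled in
`ℝ≥0∞`, even if a moment is infinite. -/
lemma load_identities (hn : 0 < m * r) {a M₁ M₂ : ℝ≥0∞} :
    ((a * r * M₁ < (m * r : ℕ)) → a * (M₁ * (m : ℝ≥0∞)⁻¹) < 1) ∧
    a * (M₂ * (m : ℝ≥0∞)⁻¹) / (2 * (1 - a * (M₁ * (m : ℝ≥0∞)⁻¹)))
      = a * r * M₂ / (2 * ((m * r : ℕ) - a * r * M₁)) := by
  have hm0 : (m : ℝ≥0∞) ≠ 0 := by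
    simpa using (Nat.pos_of_mul_pos_right hn).ne'
  have hn0 : ((m * r : ℕ) : ℝ≥0∞) ≠ 0 := by exact_mod_cast hn.ne'
  have hnt : ((m * r : ℕ) : ℝ≥0∞) ≠ ∞ := ENNReal.natCast_ne_top _
  have hmul : ∀ M : ℝ≥0∞, ((m * r : ℕ) : ℝ≥0∞) * (a * (M * (m : ℝ≥0∞)⁻¹)) = a * r * M := by
    intro M
    calc ((m * r : ℕ) : ℝ≥0∞) * (a * (M * (m : ℝ≥0∞)⁻¹))
        = (m * (m : ℝ≥0∞)⁻¹) * (a * r * M) := by push_cast; ring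
      _ = a * r * M := by
        rw [ENNReal.mul_inv_cancel hm0 (ENNReal.natCast_ne_top m), one_mul]
  constructor
  · intro hlt
    rw [← hmul M₁] at hlt
    by_contra hge
    have := mul_le_mul_right (not_lt.1 hge) ((m * r : ℕ) : ℝ≥0∞)
    rw [mul_one] at this
    exact absurd hlt (not_lt.2 this)
  · rw [← ENNReal.mul_div_mul_left _ _ hn0 hnt, hmul M₂, mul_left_comm,
      ENNReal.mul_sub (fun _ _ => hnt), mul_one, hmul M₁]

/-- The steady state of the latency. -/
theorem steadyState (h : IsGroupBasedSystem P F r grp A G X) (hF : F (Set.Iic 0) = 0)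
    (hm : 0 < m) (hr : 0 < r) (hlam : 0 < lam) (hpois : IsPoissonArrivals P lam A)
    (hload : ENNReal.ofReal lam * r * minMoment F r 1 < (m * r : ℕ)) :
    (∃ ν : ProbabilityMeasure ℝ, IsSteadyStateLaw P (groupLatency grp A G X) ν ∧
      ∫⁻ t, ENNReal.ofReal t ∂(ν : Measure ℝ) = minMoment F r 1
        + ENNReal.ofReal lam * r * minMoment F r 2
          / (2 * ((m * r : ℕ) - ENNReal.ofReal lam * r * minMoment F r 1))) ∧
    Tendsto (fun j => ∫⁻ ω, ENNReal.ofReal (groupLatency grp A G X j ω) ∂P) atTop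
      (𝓝 (minMoment F r 1 + ENNReal.ofReal lam * r * minMoment F r 2
          / (2 * ((m * r : ℕ) - ENNReal.ofReal lam * r * minMoment F r 1)))) := by
  -- Any group would do, as the latency has the same law in all of them.
  let g : Fin m := ⟨0, hm⟩
  have hq := h.isQueueInput hpois g
  have hids := load_identities (Nat.mul_pos hm hr) (a := ENNReal.ofReal lam)
    (M₁ := minMoment F r 1) (M₂ := minMoment F r 2)
  have hload' : ENNReal.ofReal lam * IsQueueInput.workMoment P (work grp G X g) 1 < 1 := by
    rw [h.workMoment_work hF g one_ne_zero]
    exact hids.1 hload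
  have hpk := hq.tendsto_backMoment hlam hload'
  have hlimmean := hq.lintegral_limitBacklog hlam hload' 1
  rw [h.workMoment_work hF g one_ne_zero, h.workMoment_work hF g two_ne_zero, hids.2]
    at hpk hlimmean
  have hsm : Measurable (service grp X g 0) := h.measurable_service_group g 0
  have hsmean := h.lintegral_service hF g 0 1
  simp only [pow_one] at hsmean
  have hLm : Measurable (limitLatency grp A G X g) := hsm.add (hq.measurable_limitBacklog 1)
  have hid := h.identDistrib_groupLatency hF hr hpois g
  have hdist : TendstoInDistribution (monotoneLatency grp A G X g) atTop
      (limitLatency grp A G X g) (fun _ => P) P :=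
    tendstoInDistribution_of_ae_tendsto (fun j => (hid j).aemeasurable_fst) hLm.aemeasurable
      ((hq.ae_tendsto_backlog hlam hload' 1).mono fun ω hω => tendsto_const_nhds.add hω)
  obtain ⟨ν, hν⟩ : ∃ ν : ProbabilityMeasure ℝ,
      (ν : Measure ℝ) = P.map (limitLatency grp A G X g) :=
    ⟨⟨_, Measure.isProbabilityMeasure_map hLm.aemeasurable⟩, rfl⟩
  refine ⟨⟨ν, ?_, ?_⟩, ?_⟩
  · refine ⟨fun j => (hid j).aemeasurable_snd, aemeasurable_id, ?_⟩
    refine (Tendsto.congr (fun j => Subtype.ext (hid j).map_eq) hdist.tendsto).mono_right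
      (le_of_eq (congrArg 𝓝 (Subtype.ext ?_)))
    exact (Measure.map_id.trans hν).symm
  · rw [hν, lintegral_map (by fun_prop) hLm, ← hlimmean, ← hsmean, ← lintegral_add_left (by fun_prop)]
    refine lintegral_congr fun ω => ?_
    rw [limitLatency, ENNReal.ofReal_add (service_nonneg grp X g 0 ω)
      (IsQueueInput.limitBacklog_nonneg _ _ _ _)]
  · refine (tendsto_const_nhds.add hpk).congr fun j => ?_
    have hint := ((hid j).comp (u := ENNReal.ofReal) (by fun_prop)).lintegral_eq
    simp only [Function.comp_apply] at hint
    rw [← hint, ← hsmean,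
      ← hq.lintegral_backlog_pow 1 j 1, ← lintegral_add_left (by fun_prop)]
    refine lintegral_congr fun ω => ?_
    rw [pow_one, monotoneLatency, ENNReal.ofReal_add
      (service_nonneg grp X g 0 ω) (backlog_nonneg _ _ _ _)]

end IsGroupBasedSystem

end ForkJoin

end

theorem mainTheorem8 {Ω : Type*} [MeasurableSpace Ω] (P : Measure Ω) [IsProbabilityMeasure P]
    (F : Measure ℝ) [IsProbabilityMeasure F] (hF : F (Set.Iic 0) = 0)
    (n r : ℕ) (hn : 0 < n) (hrn : r ∣ n)
    (grp : Fin n → Fin (n / r)) (A : ℕ → Ω → ℝ) (G : ℕ → Ω → Fin (n / r))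
    (X : ℕ → Fin n → Ω → ℝ)
    (hsys : ForkJoin.IsGroupBasedSystem P F r grp A G X) :
    -- the expected cost of every job, for an arbitrary arrival process
    (∀ j, ∫⁻ ω, ENNReal.ofReal (ForkJoin.groupCost grp A G X j ω) ∂P
        = r * ForkJoin.minMoment F r 1) ∧
    -- the expected latency in steady state, for stable Poisson arrivals
    (∀ lam : ℝ, 0 < lam → ForkJoin.IsPoissonArrivals P lam A →
      ENNReal.ofReal lam * r * ForkJoin.minMoment F r 1 < n →
      (∃ ν : ProbabilityMeasure ℝ,
        ForkJoin.IsSteadyStateLaw P (ForkJoin.groupLatency grp A G X) ν ∧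
        ∫⁻ t, ENNReal.ofReal t ∂(ν : Measure ℝ)
          = ForkJoin.minMoment F r 1
            + ENNReal.ofReal lam * r * ForkJoin.minMoment F r 2
              / (2 * (n - ENNReal.ofReal lam * r * ForkJoin.minMoment F r 1))) ∧
      Tendsto (fun j => ∫⁻ ω, ENNReal.ofReal (ForkJoin.groupLatency grp A G X j ω) ∂P) atTop
        (𝓝 (ForkJoin.minMoment F r 1
            + ENNReal.ofReal lam * r * ForkJoin.minMoment F r 2
              / (2 * (n - ENNReal.ofReal lam * r * ForkJoin.minMoment F r 1))))) := by
  have hr : 0 < r := Nat.pos_of_dvd_of_pos hrn hn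
  have hm : 0 < n / r := Nat.div_pos (Nat.le_of_dvd hn hrn) hr
  refine ⟨hsys.lintegral_groupCost hF hr, fun lam hlam hpois hload => ?_⟩
  have hnmr : (n : ℝ≥0∞) = (n / r * r : ℕ) := by rw [Nat.div_mul_cancel hrn]
  rw [hnmr] at hload ⊢
  exact hsys.steadyState hF hm hr hlam hpois hload
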